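/- Let $\lambda,a,h,\beta>0$, $\sigma\ge 0$, $\tau\ge 1$ and $\mathbf y\in\mathbb R^2$ (for instance $\mathbf y$ in the room $\mathcal S(0,a)$), where $\mathcal S(\mathbf c,a)\subset\mathbb R^2$ is the closed square with center $\mathbf c$ and sides of length $2a$. Let the locations of the transmitters (no reflections) form a homogeneous Poisson point process $\Phi$ with density $\lambda$ on $\mathcal S(0,a)$, let $\ell(\mathbf x,\mathbf y)=(|\mathbf x-\mathbf y|^2+h^2)^{-\beta}$, and for $\mathbf x\in\Phi$ put $$\mathrm{SINR}_{\mathbf x}(\mathbf y)=\frac{\ell(\mathbf x,\mathbf y)}{\sum_{\mathbf z\in\Phi\setminus\{\mathbf x\}}\ell(\mathbf z,\mathbf y)+\sigma^2}\in[0,\infty].$$ The receiver at $\mathbf y$ is associated with a transmitter $\mathbf x_0\in\Phi$ that maximizes $\ell(\cdot,\mathbf y)$, and $\mathrm{SINR}_0(\mathbf y)=\mathrm{SINR}_{\mathbf x_0}(\mathbf y)$ (which is $0$ if $\Phi=\emptyset$). Let $a_{\mathrm D}=[\tau^{-1/\beta}\sigma^{-2/\beta}-h^2]^{1/2}$, with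 $a_{\mathrm D}=\infty$ if $\sigma=0$ and $a_{\mathrm D}=0$ if the bracket is negative, and let $\mathcal A_{\mathbf y}=\mathcal S(-\mathbf y,a)\cap\mathcal B(0,a_{\mathrm D})$, where $\mathcal B(0,r)$ is the open disc of radius $r$ around $0$. Then the SINR coverage probability $P_c(\tau,\mathbf y)=\mathbb P[\mathrm{SINR}_0(\mathbf y)>\tau]$ is $$P_c(\tau,\mathbf y)=\frac{\lambda|\mathcal A_{\mathbf y}|}{2}-\frac{\lambda}{\pi}\int_0^\infty\frac1t\,\mathrm{Im}\!\left[e^{jt\sigma^2}\,\mathcal F(jt\tau^{-1},\mathcal A_{\mathbf y})\,\mathcal K(jt,\mathcal S(-\mathbf y,a))\right]\mathrm dt,$$ where the integral converges absolutely, $j$ is the imaginary unit, and $$\mathcal F(s,\mathcal A)=\int_{\mathcal A}e^{-s(|\mathbf x|^2+h^2)^{-\beta}}\,\mathrm d\mathbf x,\qquad \mathcal K(s,\mathcal A)=\exp\!\left(-\lambda\int_{\mathcal A}\left(1-\exp\!\left[\frac{s}{(|\mathbf z|^2+h^2)^{\beta}}\right]\right)\mathrm d\mathbf z\right).$$ 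-/

import Mathlib

open MeasureTheory ProbabilityTheory Set Function

open scoped ENNReal NNReal

noncomputable section

namespace VLC

/-- The horizontal plane `ℝ²` with the Euclidean norm and Lebesgue measure. -/
abbrev Plane : Type := EuclideanSpace ℝ (Fin 2)

/-- The random set `Φ` of points of the plane is a (simple) Poisson point process with intensity
measure `Λ` under the probability measure `P`: the numbers of points in measurable sets are random
variables, they are Poisson distributed with mean `Λ B` when this is finite, and they are
independent for pairwise disjoint sets. -/
structure IsPoissonProcess {Ω : Type*} [MeasurableSpace Ω] (Φ : Ω → Set Plane)
    (Λ : Measure Plane) (P : Measure Ω) : Prop where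
  measurable_count : ∀ B : Set Plane, MeasurableSet B →
    Measurable fun ω => (Φ ω ∩ B).encard
  law_count : ∀ B : Set Plane, MeasurableSet B → Λ B ≠ ∞ →
    P.map (fun ω => (Φ ω ∩ B).encard)
      = (poissonMeasure (Λ B).toNNReal).map (fun n : ℕ => (n : ℕ∞))
  indep_count : ∀ (n : ℕ) (B : Fin n → Set Plane), (∀ i, MeasurableSet (B i)) →
    Pairwise (Disjoint on B) → iIndepFun (fun i ω => (Φ ω ∩ B i).encard) P

/-- The square `S(c, a)` with center `c` and sides of length `2 * a`. -/
def square (c : Plane) (a : ℝ) : Set Plane := {x | ∀ i, |x i - c i| ≤ a}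

/-- The homogeneous Poisson point process of density `lam` in the room `S(0, a)`. -/
def IsHomogeneousPoissonProcess {Ω : Type*} [MeasurableSpace Ω] (Φ : Ω → Set Plane)
    (lam a : ℝ) (P : Measure Ω) : Prop :=
  IsPoissonProcess Φ (ENNReal.ofReal lam • (volume.restrict (square 0 a))) P

/-- The path loss `ℓ(x, y) = (|x - y|² + h²)^(-β)` between an attocell at `(x, h)` and a receiver
at `(y, 0)`. -/
def pathLoss (h β : ℝ) (x y : Plane) : ℝ := (‖x - y‖ ^ 2 + h ^ 2) ^ (-β)

/-- The sum interference `I(φ)` at the receiver `y` from the set `φ` of attocells. -/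
def interference (h β : ℝ) (y : Plane) (φ : Set Plane) : ℝ≥0∞ :=
  ∑' x : φ, ENNReal.ofReal (pathLoss h β x y)

/-- The SINR at `y` if it is associated with the attocell at `x`, for the set `φ` of attocells and
the effective noise `σ ^ 2`. The value is `∞` exactly when there is neither noise nor
interference. -/
def sinr (h β σ : ℝ) (y : Plane) (φ : Set Plane) (x : Plane) : ℝ≥0∞ :=
  ENNReal.ofReal (pathLoss h β x y) /
    (interference h β y (φ \ {x}) + ENNReal.ofReal (σ ^ 2))

/-- The attocell at `x` serves the receiver `y`: it has the maximum received power. -/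
def IsServing (h β : ℝ) (y : Plane) (φ : Set Plane) (x : Plane) : Prop :=
  x ∈ φ ∧ ∀ z ∈ φ, pathLoss h β z y ≤ pathLoss h β x y

/-- The SINR of the receiver `y`, which is associated with a serving attocell; it is `0` if there
is no such attocell. By `servedSinr_eq` the choice among several of them does not matter. -/
def servedSinr (h β σ : ℝ) (y : Plane) (φ : Set Plane) : ℝ≥0∞ :=
  ⨆ x, ⨆ _ : IsServing h β y φ x, sinr h β σ y φ x

theorem interference_add (h β : ℝ) (y : Plane) (φ : Set Plane) {x : Plane} (hx : x ∈ φ) :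
    ENNReal.ofReal (pathLoss h β x y) + interference h β y (φ \ {x}) = interference h β y φ := by
  have h1 := ENNReal.summable.tsum_union_disjoint
    (f := fun z : Plane => ENNReal.ofReal (pathLoss h β z y))
    (disjoint_sdiff_right : Disjoint {x} (φ \ {x})) ENNReal.summable
  rw [Set.union_sdiff_cancel (Set.singleton_subset_iff.2 hx), tsum_singleton x
    (fun z : Plane => ENNReal.ofReal (pathLoss h β z y))] at h1
  exact h1.symm

theorem servedSinr_eq (h β σ : ℝ) (y : Plane) (φ : Set Plane) {x : Plane}
    (hx : IsServing h β y φ x) : servedSinr h β σ y φ = sinr h β σ y φ x := by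
  refine le_antisymm (iSup₂_le fun z hz => ?_) (le_iSup₂_of_le x hx le_rfl)
  have hxz : pathLoss h β z y = pathLoss h β x y := le_antisymm (hx.2 z hz.1) (hz.2 x hx.1)
  have hI : interference h β y (φ \ {z}) = interference h β y (φ \ {x}) := by
    have e := (interference_add h β y φ hz.1).trans (interference_add h β y φ hx.1).symm
    rw [hxz] at e
    exact (ENNReal.add_right_inj ENNReal.ofReal_ne_top).1 e
  rw [sinr, sinr, hxz, hI]

/-- The SINR coverage probability of a receiver at `y` for the random set `Φ` of attocells: the
probability that its SINR is greater than the threshold `τ`. -/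
def coverageProbability {Ω : Type*} [MeasurableSpace Ω] (P : Measure Ω) (Φ : Ω → Set Plane)
    (h β σ τ : ℝ) (y : Plane) : ℝ :=
  P.real {ω | ENNReal.ofReal τ < servedSinr h β σ y (Φ ω)}

/-- The radius `a_D = (τ^(-1/β) σ^(-2/β) - h²)^(1/2)`, computed in `[0, ∞]`: it is `∞` if `σ = 0`,
and `0` if the difference is negative. -/
def radiusD (h β σ τ : ℝ) : ℝ≥0∞ :=
  (ENNReal.ofReal τ ^ (-(1 / β)) * ENNReal.ofReal σ ^ (-(2 / β)) - ENNReal.ofReal h ^ 2)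
    ^ (1 / 2 : ℝ)

/-- The set `A_y = S(-y, a) ∩ B(0, a_D)`, with the open ball. -/
def regionA (a h β σ τ : ℝ) (y : Plane) : Set Plane :=
  square (-y) a ∩ {x | ENNReal.ofReal ‖x‖ < radiusD h β σ τ}

/-- `F(s, A) = ∫_A exp(-s (|x|² + h²)^(-β)) dx`. -/
def funF (h β : ℝ) (s : ℂ) (A : Set Plane) : ℂ :=
  ∫ x in A, Complex.exp (-s * (((‖x‖ ^ 2 + h ^ 2) ^ (-β) : ℝ) : ℂ))

/-- `K(s, A) = exp(-λ ∫_A (1 - exp(s / (|z|² + h²)^β)) dz)`. -/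
def funK (lam h β : ℝ) (s : ℂ) (A : Set Plane) : ℂ :=
  Complex.exp (-(lam : ℂ) *
    ∫ z in A, (1 - Complex.exp (s / (((‖z‖ ^ 2 + h ^ 2) ^ β : ℝ) : ℂ))))

/-- The integrand `(1 / t) Im[exp(j t σ²) F(j t / τ, A_y) K(j t, S(-y, a))]`. -/
def coverageIntegrand (lam a h β σ τ : ℝ) (y : Plane) (t : ℝ) : ℝ :=
  1 / t * (Complex.exp (Complex.I * t * (σ : ℂ) ^ 2) *
    funF h β (Complex.I * t / τ) (regionA a h β σ τ y) *
    funK lam h β (Complex.I * t) (square (-y) a)).im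

end VLC

end

/-! Write `J` for the total received power and `g x` for the power from `x`. The SINR at `x` exceeds
`τ` iff `J - g x + σ² - g x / τ < 0`. Since `τ ≥ 1`, such a point is strictly stronger than every
other one, so it is unique and serves the receiver. The coverage event is therefore a disjoint union
over the points of `Φ`, and the reduced Campbell formula (`measure_exists_lt`) turns its probability
into the integral over `x` of `λ P(J + σ² - g x / τ < 0)`. The integrand vanishes outside `A_y`.
Hence the coverage probability is `λ` times the mass of `(-∞, 0)` under the convolution of the law
`μ` of `J` with the image `κ` of Lebesgue measure on `A_y` under `σ² - g / τ`.

Gil-Pelaez inversion (`measureReal_Iio_zero_eq`) evaluates this mass. The total mass is `|A_y|`; the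
characteristic function is `K` for `μ` (`charFun_finsum`) times `exp(jtσ²) F` for `κ`. Absolute
convergence near `0` follows from a finite first moment. At infinity it comes from `κ` alone,
because `μ` has an atom at `0` (no transmitters): the path loss pushes area on a disc to a bounded
density (`exists_setIntegral_exp_pathLoss_le`), so the characteristic function of `κ` is square
integrable (`integrableOn_sq_norm_charFun`), which is enough against `1 / t`.

The Poisson facts are proved by rounding `g` to finitely many values, where only independent Poisson
counts occur, and passing to the limit. -/

/-! ### Gil-Pelaez inversion for finite measures on the line. -/

theorem abs_sin_mul_div_le (t x : ℝ) : |Real.sin (t * x) / t| ≤ |x| := by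
  rcases eq_or_ne t 0 with rfl | ht
  · simp
  rw [abs_div, div_le_iff₀ (abs_pos.2 ht), mul_comm, ← abs_mul]
  exact Real.abs_sin_le_abs

theorem integral_exp_neg_mul_cos {ε : ℝ} (hε : 0 < ε) (x : ℝ) :
    ∫ t in Ioi (0 : ℝ), Real.exp (-ε * t) * Real.cos (t * x) = ε / (ε ^ 2 + x ^ 2) := by
  have ha : (-(ε : ℂ) + x * Complex.I).re < 0 := by simpa using hε
  have h := congrArg Complex.re (integral_exp_mul_complex_Ioi ha 0)
  have h2 := integral_re (𝕜 := ℂ) (integrableOn_exp_mul_complex_Ioi ha 0)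
  simp only [RCLike.re_to_complex] at h2
  rw [← h2] at h
  have e : ∀ t : ℝ, (Complex.exp ((-(ε : ℂ) + x * Complex.I) * t)).re
      = Real.exp (-ε * t) * Real.cos (t * x) := fun t => by
    rw [Complex.exp_re]; simp [mul_comm]
  simp only [e] at h
  rw [h]
  simp only [Complex.ofReal_zero, mul_zero, Complex.exp_zero, neg_div, Complex.neg_re, one_div,
    Complex.inv_re, Complex.normSq_apply]
  simp
  ring_nf

theorem integrableOn_exp_neg_mul {ε : ℝ} (hε : 0 < ε) :
    IntegrableOn (fun t : ℝ => Real.exp (-ε * t)) (Ioi 0) :=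
  integrableOn_exp_mul_Ioi (by linarith) 0

/-- A Laplace-regularized Dirichlet integral. -/
theorem integral_exp_neg_mul_sin_div {ε : ℝ} (hε : 0 < ε) (x : ℝ) :
    ∫ t in Ioi (0 : ℝ), Real.exp (-ε * t) * (Real.sin (t * x) / t) = Real.arctan (x / ε) := by
  have hd : ∀ x : ℝ, HasDerivAt
      (fun x => ∫ t in Ioi (0 : ℝ), Real.exp (-ε * t) * (Real.sin (t * x) / t))
      (ε / (ε ^ 2 + x ^ 2)) x := fun x => by
    rw [← integral_exp_neg_mul_cos hε]
    have hm : ∀ x : ℝ, AEStronglyMeasurable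
        (fun t : ℝ => Real.exp (-ε * t) * (Real.sin (t * x) / t)) (volume.restrict (Ioi 0)) :=
      fun x => by
        have : Measurable (fun t : ℝ => Real.exp (-ε * t) * (Real.sin (t * x) / t)) := by fun_prop
        exact this.aestronglyMeasurable
    refine (hasDerivAt_integral_of_dominated_loc_of_deriv_le (s := univ) (x₀ := x)
      (F := fun x t => Real.exp (-ε * t) * (Real.sin (t * x) / t))
      (F' := fun x t => Real.exp (-ε * t) * Real.cos (t * x))
      (bound := fun t => Real.exp (-ε * t)) Filter.univ_mem
      (Filter.Eventually.of_forall hm) ?_ ?_ ?_ (integrableOn_exp_neg_mul hε) ?_).2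
    · refine ((integrableOn_exp_neg_mul hε).mul_const |x|).mono' (hm x) ?_
      refine Filter.Eventually.of_forall fun t => ?_
      rw [norm_mul, Real.norm_eq_abs, Real.abs_exp]
      exact mul_le_mul_of_nonneg_left (abs_sin_mul_div_le t x) (Real.exp_nonneg _)
    · exact (by fun_prop : Continuous fun t : ℝ => Real.exp (-ε * t) * Real.cos (t * x))
        |>.aestronglyMeasurable
    · refine Filter.Eventually.of_forall fun t x _ => ?_
      rw [norm_mul, Real.norm_eq_abs, Real.abs_exp]
      exact mul_le_of_le_one_right (Real.exp_nonneg _) (Real.abs_cos_le_one _)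
    · filter_upwards [ae_restrict_mem measurableSet_Ioi] with t ht x _
      have ht' : t ≠ 0 := (mem_Ioi.1 ht).ne'
      have := ((((hasDerivAt_id x).const_mul t).sin).div_const t).const_mul (Real.exp (-ε * t))
      convert! this using 1
      simp only [id]
      field_simp
  have hd' : ∀ x : ℝ, HasDerivAt (fun x => Real.arctan (x / ε)) (ε / (ε ^ 2 + x ^ 2)) x :=
    fun x => by
      have := ((hasDerivAt_id x).div_const ε).arctan
      convert! this using 1
      simp only [id]
      field_simp
  -- Both sides have the same derivative in `x` and vanish at `x = 0`.
  have hc := is_const_of_deriv_eq_zero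
    (f := fun x => (∫ t in Ioi (0 : ℝ), Real.exp (-ε * t) * (Real.sin (t * x) / t))
      - Real.arctan (x / ε))
    (fun x => ((hd x).sub (hd' x)).differentiableAt)
    (fun x => ((hd x).sub (hd' x)).deriv.trans (sub_self _)) x 0
  simpa [sub_eq_zero] using hc

theorem charFun_im (ν : Measure ℝ) [IsFiniteMeasure ν] (t : ℝ) :
    (charFun ν t).im = ∫ x, Real.sin (t * x) ∂ν := by
  rw [charFun_apply_real]
  have hi : Integrable (fun x : ℝ => Complex.exp (t * x * Complex.I)) ν := by
    refine (integrable_const (1 : ℝ)).mono'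
      (by fun_prop : Continuous fun x : ℝ => Complex.exp (t * x * Complex.I)).aestronglyMeasurable
      (Filter.Eventually.of_forall fun x => ?_)
    rw [← Complex.ofReal_mul, Complex.norm_exp_ofReal_mul_I]
  have h2 := integral_im (𝕜 := ℂ) hi
  simp only [RCLike.im_to_complex] at h2
  rw [← h2]
  congr 1 with x
  rw [← Complex.ofReal_mul, Complex.exp_ofReal_mul_I_im]

/-- A finite first moment cancels the singularity of `1 / t` at `0`, since `sin (t x)` is at most
`|t x|`. -/
theorem abs_charFun_im_div_le (ν : Measure ℝ) [IsFiniteMeasure ν] (hν : Integrable id ν) (t : ℝ) :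
    |1 / t * (charFun ν t).im| ≤ ∫ x, |x| ∂ν := by
  rw [charFun_im, ← integral_const_mul]
  refine abs_integral_le_integral_abs.trans ?_
  refine integral_mono_of_nonneg (Filter.Eventually.of_forall fun x => abs_nonneg _) hν.abs
    (Filter.Eventually.of_forall fun x => ?_)
  have := abs_sin_mul_div_le t x
  rwa [div_eq_inv_mul, ← one_div] at this

/-- Fubini and the regularized Dirichlet integral; the damping makes `exp(-ε t) |x|` an integrable
majorant on the product. -/
theorem integral_exp_neg_mul_charFun_im (ν : Measure ℝ) [IsFiniteMeasure ν] (hν : Integrable id ν)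
    {ε : ℝ} (hε : 0 < ε) :
    ∫ t in Ioi (0 : ℝ), Real.exp (-ε * t) * (1 / t * (charFun ν t).im)
      = ∫ x, Real.arctan (x / ε) ∂ν := by
  simp_rw [← integral_exp_neg_mul_sin_div hε]
  rw [← integral_integral_swap]
  · congr 1 with t
    rw [charFun_im, ← integral_const_mul, ← integral_const_mul]
    congr 1 with x
    ring
  · have h1 : Integrable (fun p : ℝ × ℝ => Real.exp (-ε * p.1) * |p.2|)
        ((volume.restrict (Ioi 0)).prod ν) :=
      Integrable.mul_prod (f := fun t => Real.exp (-ε * t)) (g := fun x => |x|)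
        (integrableOn_exp_neg_mul hε) hν.abs
    refine h1.mono' ?_ (Filter.Eventually.of_forall fun p => ?_)
    · have : Measurable (fun p : ℝ × ℝ => Real.exp (-ε * p.1) * (Real.sin (p.1 * p.2) / p.1)) := by
        fun_prop
      exact this.aestronglyMeasurable
    · simp only [Function.uncurry]
      rw [norm_mul, Real.norm_eq_abs, Real.abs_exp]
      exact mul_le_mul_of_nonneg_left (abs_sin_mul_div_le _ _) (Real.exp_nonneg _)

theorem tendsto_arctan_mul_natCast (x : ℝ) :
    Filter.Tendsto (fun n : ℕ => Real.arctan (x / (1 / ((n : ℝ) + 1)))) Filter.atTop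
      (nhds (Real.pi / 2 * SignType.sign x)) := by
  have hn : Filter.Tendsto (fun n : ℕ => (n : ℝ) + 1) Filter.atTop Filter.atTop :=
    Filter.tendsto_atTop_add_const_right _ _ tendsto_natCast_atTop_atTop
  simp only [div_div_eq_mul_div, div_one]
  rcases lt_trichotomy x 0 with hx | rfl | hx
  · have h := Real.tendsto_arctan_atBot.comp (hn.const_mul_atTop_of_neg hx)
    simpa [sign_neg hx, Function.comp_def] using h.mono_right nhdsWithin_le_nhds
  · simp
  · have h := Real.tendsto_arctan_atTop.comp (hn.const_mul_atTop hx)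
    simpa [sign_pos hx, Function.comp_def] using h.mono_right nhdsWithin_le_nhds

/-- Off the null set `{0}`, the sign is `1` minus twice the indicator of the negative half-line. -/
theorem integral_sign (ν : Measure ℝ) [IsFiniteMeasure ν] (h0 : ν {0} = 0) :
    ∫ x, ((SignType.sign x : SignType) : ℝ) ∂ν = ν.real univ - 2 * ν.real (Iio 0) := by
  have e : (fun x : ℝ => ((SignType.sign x : SignType) : ℝ)) =ᵐ[ν]
      fun x => 1 - 2 * (Iio (0 : ℝ)).indicator 1 x := by
    have : ∀ᵐ x ∂ν, x ≠ 0 := by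
      rw [ae_iff]; simpa using h0
    filter_upwards [this] with x hx
    rcases lt_or_gt_of_ne hx with h | h
    · simp [sign_neg h, h]; norm_num
    · simp [sign_pos h, h.le]
  have hi : Integrable (fun x : ℝ => 2 * (Iio (0 : ℝ)).indicator (1 : ℝ → ℝ) x) ν :=
    ((integrable_const (1 : ℝ)).indicator measurableSet_Iio).const_mul 2
  rw [integral_congr_ae e, integral_sub (integrable_const _) hi, integral_const_mul,
    integral_indicator_one measurableSet_Iio]
  simp

/-- **Gil-Pelaez inversion** at `0` for finite measures. -/
theorem measureReal_Iio_zero_eq (ν : Measure ℝ) [IsFiniteMeasure ν] (hν : Integrable id ν)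
    (h0 : ν {0} = 0) (hi : IntegrableOn (fun t => 1 / t * (charFun ν t).im) (Ioi 0)) :
    ν.real (Iio 0) = ν.real univ / 2
      - 1 / Real.pi * ∫ t in Ioi (0 : ℝ), 1 / t * (charFun ν t).im := by
  have hpos : ∀ n : ℕ, (0 : ℝ) < 1 / ((n : ℝ) + 1) := fun n => by positivity
  have l1 : Filter.Tendsto (fun n : ℕ => ∫ t in Ioi (0 : ℝ),
      Real.exp (-(1 / ((n : ℝ) + 1)) * t) * (1 / t * (charFun ν t).im)) Filter.atTop
      (nhds (∫ t in Ioi (0 : ℝ), 1 / t * (charFun ν t).im)) := by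
    refine tendsto_integral_of_dominated_convergence _ (fun n => ?_) hi.norm (fun n => ?_) ?_
    · exact (by fun_prop : Continuous fun t : ℝ => Real.exp (-(1 / ((n : ℝ) + 1)) * t))
        |>.aestronglyMeasurable.mul hi.aestronglyMeasurable
    · filter_upwards [ae_restrict_mem measurableSet_Ioi] with t ht
      rw [norm_mul, Real.norm_eq_abs, Real.abs_exp]
      refine mul_le_of_le_one_left (norm_nonneg _) (Real.exp_le_one_iff.2 ?_)
      nlinarith [hpos n, mem_Ioi.1 ht]
    · refine Filter.Eventually.of_forall fun t => ?_
      have h := (((tendsto_one_div_add_atTop_nhds_zero_nat (𝕜 := ℝ)).neg.mul_const t).rexp).mul_const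
        (1 / t * (charFun ν t).im)
      simpa using h
  have l2 : Filter.Tendsto (fun n : ℕ => ∫ x, Real.arctan (x / (1 / ((n : ℝ) + 1))) ∂ν) Filter.atTop
      (nhds (∫ x, Real.pi / 2 * ((SignType.sign x : SignType) : ℝ) ∂ν)) := by
    refine tendsto_integral_of_dominated_convergence (fun _ => Real.pi / 2) (fun n => ?_)
      (integrable_const _) (fun n => Filter.Eventually.of_forall fun x => ?_)
      (Filter.Eventually.of_forall tendsto_arctan_mul_natCast)
    · exact (Real.measurable_arctan.comp (measurable_id.div_const _)).aestronglyMeasurable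
    · exact abs_le.2 ⟨(Real.neg_pi_div_two_lt_arctan _).le, (Real.arctan_lt_pi_div_two _).le⟩
  -- The damped integrals with `ε = 1 / (n + 1)` now have two limits, which must agree.
  simp_rw [integral_exp_neg_mul_charFun_im ν hν (hpos _)] at l1
  have := tendsto_nhds_unique l1 l2
  rw [integral_const_mul, integral_sign ν h0] at this
  rw [this]
  field_simp
  ring

/-! ### Decay of the characteristic function of a measure with bounded density. -/

theorem charFun_mul_conj (ν : Measure ℝ) [IsFiniteMeasure ν] (t : ℝ) :
    ((‖charFun ν t‖ ^ 2 : ℝ) : ℂ)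
      = ∫ p : ℝ × ℝ, Complex.exp (((p.1 - p.2 : ℝ) : ℂ) * t * Complex.I) ∂ν.prod ν := by
  rw [Complex.ofReal_pow, ← Complex.mul_conj', ← charFun_neg, charFun_apply_real,
    charFun_apply_real, ← integral_prod_mul]
  congr 1 with p
  rw [← Complex.exp_add]
  push_cast
  ring_nf

/-- `|charFun ν|²` is the characteristic function of the difference of two coordinates under `ν ×
ν`; averaging it over a Gaussian frequency replaces each exponential by the Gaussian characteristic
function. -/
theorem integral_sq_norm_charFun_gaussianReal (ν : Measure ℝ) [IsFiniteMeasure ν] (v : ℝ≥0) :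
    ∫ t, ‖charFun ν t‖ ^ 2 ∂gaussianReal 0 v
      = ∫ p : ℝ × ℝ, Real.exp (-(v * (p.1 - p.2) ^ 2) / 2) ∂ν.prod ν := by
  have h : ∫ t, ((‖charFun ν t‖ ^ 2 : ℝ) : ℂ) ∂gaussianReal 0 v
      = ∫ p : ℝ × ℝ, ((Real.exp (-(v * (p.1 - p.2) ^ 2) / 2) : ℝ) : ℂ) ∂ν.prod ν := by
    simp_rw [charFun_mul_conj]
    rw [integral_integral_swap]
    · congr 1 with p
      have := charFun_gaussianReal (μ := 0) (v := v) (p.1 - p.2)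
      rw [charFun_apply_real] at this
      rw [Complex.ofReal_exp]
      convert! this using 2
      push_cast
      ring
    · refine (integrable_const (1 : ℝ)).mono' (by
        have : Continuous (uncurry fun (t : ℝ) (p : ℝ × ℝ) =>
            Complex.exp (((p.1 - p.2 : ℝ) : ℂ) * t * Complex.I)) := by
          simp only [Function.uncurry_def]; fun_prop
        exact this.aestronglyMeasurable) (Filter.Eventually.of_forall fun p => ?_)
      simp only [Function.uncurry_def]
      rw [← Complex.ofReal_mul, Complex.norm_exp_ofReal_mul_I]
  rw [integral_complex_ofReal, integral_complex_ofReal] at h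
  exact_mod_cast h

/-- A finite measure whose Gaussian averages are those of a bounded density has a square
integrable characteristic function. -/
theorem integrableOn_sq_norm_charFun (ν : Measure ℝ) [IsFiniteMeasure ν] {C : ℝ}
    (hC : ∀ R : ℝ, 0 < R → ∀ c : ℝ, ∫ x, Real.exp (-(R * (x - c)) ^ 2 / 2) ∂ν ≤ C / R) :
    IntegrableOn (fun t => ‖charFun ν t‖ ^ 2) (Ioi 0) := by
  have hbd : ∀ t, ‖charFun ν t‖ ^ 2 ≤ ν.real univ ^ 2 := fun t =>
    pow_le_pow_left₀ (norm_nonneg _) (norm_charFun_le t) 2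
  have hm : Measurable fun t => ‖charFun ν t‖ ^ 2 := by
    have := measurable_charFun (μ := ν)
    fun_prop
  have hloc : ∀ R : ℝ, IntegrableOn (fun t => ‖charFun ν t‖ ^ 2) (Ioc 0 R) := fun R =>
    (integrable_const (ν.real univ ^ 2)).mono' hm.aestronglyMeasurable
      (Filter.Eventually.of_forall fun t => by simpa using hbd t)
  refine integrableOn_Ioi_of_intervalIntegral_norm_bounded (l := Filter.atTop) (b := id)
    (Real.exp (1 / 2) * √(2 * Real.pi) * (C * ν.real univ)) 0 hloc Filter.tendsto_id ?_
  filter_upwards [Filter.eventually_gt_atTop (0 : ℝ)] with R hR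
  simp only [id]
  rw [intervalIntegral.integral_of_le hR.le]
  -- With standard deviation `R`, the Gaussian density is at least `exp(-1/2) / (√(2π) R)` on `(0,
  -- R]`. This factor `R` cancels the `1 / R` of the hypothesis, so the bound is uniform in `R`.
  set v : ℝ≥0 := ⟨R ^ 2, sq_nonneg R⟩ with hv
  have hvR : (v : ℝ) = R ^ 2 := rfl
  have hv0 : v ≠ 0 := by
    intro h
    have := congrArg NNReal.toReal h
    rw [hvR] at this
    simp [hR.ne'] at this
  have h1 : ∫ t, ‖charFun ν t‖ ^ 2 ∂gaussianReal 0 v ≤ C / R * ν.real univ := by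
    rw [integral_sq_norm_charFun_gaussianReal, integral_prod_symm]
    · calc _ ≤ ∫ y, C / R ∂ν := by
            refine integral_mono_of_nonneg
              (Filter.Eventually.of_forall fun y => integral_nonneg fun x => Real.exp_nonneg _)
              (integrable_const _) (Filter.Eventually.of_forall fun y => ?_)
            refine le_of_eq_of_le ?_ (hC R hR y)
            simp only [hvR, mul_pow]
      _ = _ := by simp [mul_comm]
    · refine (integrable_const (1 : ℝ)).mono'
        (by fun_prop : Continuous fun p : ℝ × ℝ =>
          Real.exp (-(v * (p.1 - p.2) ^ 2) / 2)).aestronglyMeasurable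
        (Filter.Eventually.of_forall fun p => ?_)
      rw [Real.norm_eq_abs, Real.abs_exp, Real.exp_le_one_iff]
      have : 0 ≤ (v : ℝ) * (p.1 - p.2) ^ 2 := by positivity
      linarith
  have hint : Integrable (fun t => ‖charFun ν t‖ ^ 2) (gaussianReal 0 v) :=
    (integrable_const (ν.real univ ^ 2)).mono' hm.aestronglyMeasurable
      (Filter.Eventually.of_forall fun t => by simpa using hbd t)
  have hint' : Integrable (fun t => gaussianPDFReal 0 v t * ‖charFun ν t‖ ^ 2) := by
    refine ((integrable_gaussianPDFReal 0 v).mul_const (ν.real univ ^ 2)).mono'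
      ((measurable_gaussianPDFReal 0 v).mul hm).aestronglyMeasurable
      (Filter.Eventually.of_forall fun t => ?_)
    rw [Real.norm_eq_abs, abs_of_nonneg (mul_nonneg (gaussianPDFReal_nonneg _ _ _) (by positivity))]
    exact mul_le_mul_of_nonneg_left (hbd t) (gaussianPDFReal_nonneg _ _ _)
  rw [integral_gaussianReal_eq_integral_smul hv0] at h1
  simp only [smul_eq_mul] at h1
  have hs : 0 < √(2 * Real.pi) := by positivity
  have hpdf : ∀ t ∈ Ioc 0 R,
      (1 : ℝ) ≤ Real.exp (1 / 2) * √(2 * Real.pi) * R * gaussianPDFReal 0 v t := by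
    intro t ht
    have e : √(2 * Real.pi * v) = √(2 * Real.pi) * R := by
      rw [hvR, Real.sqrt_mul (by positivity), Real.sqrt_sq hR.le]
    rw [gaussianPDFReal, e, mul_inv]
    have e2 : Real.exp (1 / 2) * √(2 * Real.pi) * R * ((√(2 * Real.pi))⁻¹ * R⁻¹ *
        Real.exp (-(t - 0) ^ 2 / (2 * v))) = Real.exp (1 / 2 + -(t - 0) ^ 2 / (2 * v)) := by
      rw [Real.exp_add]
      field_simp
    rw [e2, Real.one_le_exp_iff, hvR, neg_div, ← sub_eq_add_neg, sub_nonneg,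
      div_le_div_iff₀ (by positivity) (by positivity)]
    nlinarith [ht.1, ht.2]
  calc ∫ t in Ioc 0 R, ‖‖charFun ν t‖ ^ 2‖
      ≤ ∫ t in Ioc 0 R, Real.exp (1 / 2) * √(2 * Real.pi) * R *
          (gaussianPDFReal 0 v t * ‖charFun ν t‖ ^ 2) := by
        refine setIntegral_mono_on (hloc R).norm (hint'.const_mul _).integrableOn measurableSet_Ioc
          fun t ht => ?_
        rw [← mul_assoc, Real.norm_eq_abs, abs_of_nonneg (by positivity)]
        exact le_mul_of_one_le_left (by positivity) (hpdf t ht)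
    _ = Real.exp (1 / 2) * √(2 * Real.pi) * R *
          ∫ t in Ioc 0 R, gaussianPDFReal 0 v t * ‖charFun ν t‖ ^ 2 := integral_const_mul _ _
    _ ≤ Real.exp (1 / 2) * √(2 * Real.pi) * R * (C / R * ν.real univ) := by
        gcongr
        refine (setIntegral_le_integral hint' (Filter.Eventually.of_forall fun t => ?_)).trans h1
        exact mul_nonneg (gaussianPDFReal_nonneg _ _ _) (by positivity)
    _ = _ := by field_simp

/-- A product is at most the sum of the two squares, and both `t⁻²` and `‖charFun ν t‖²` are
integrable beyond `1`. -/
theorem integrableOn_inv_mul_norm_charFun (ν : Measure ℝ) [IsFiniteMeasure ν] {C : ℝ}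
    (hC : ∀ R : ℝ, 0 < R → ∀ c : ℝ, ∫ x, Real.exp (-(R * (x - c)) ^ 2 / 2) ∂ν ≤ C / R) :
    IntegrableOn (fun t => 1 / t * ‖charFun ν t‖) (Ioi 1) := by
  have h1 := (integrableOn_sq_norm_charFun ν hC).mono_set (Ioi_subset_Ioi zero_le_one)
  have h2 : IntegrableOn (fun t : ℝ => t ^ (-2 : ℝ)) (Ioi 1) :=
    integrableOn_Ioi_rpow_of_lt (by norm_num) one_pos
  have hm : Measurable fun t => 1 / t * ‖charFun ν t‖ := by
    have := measurable_charFun (μ := ν)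
    fun_prop
  refine (h1.add h2).mono' hm.aestronglyMeasurable ?_
  filter_upwards [ae_restrict_mem measurableSet_Ioi] with t ht
  have ht0 : (0 : ℝ) < t := one_pos.trans ht
  simp only [Pi.add_apply]
  rw [Real.rpow_neg ht0.le, Real.rpow_two, Real.norm_eq_abs, abs_of_nonneg (by positivity),
    ← inv_pow, one_div]
  nlinarith [sq_nonneg (t⁻¹ - ‖charFun ν t‖), sq_nonneg t⁻¹, sq_nonneg ‖charFun ν t‖]

/-! ### The distribution of the path loss under Lebesgue measure. -/

theorem integral_exp_neg_sq_div_two {R : ℝ} (hR : 0 < R) (c : ℝ) :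
    ∫ x : ℝ, Real.exp (-(R * (x - c)) ^ 2 / 2) = √(2 * Real.pi) / R := by
  rw [integral_sub_right_eq_self (fun x => Real.exp (-(R * x) ^ 2 / 2)) c]
  have := integral_gaussian (R ^ 2 / 2)
  rw [div_div_eq_mul_div, Real.sqrt_div (by positivity), Real.sqrt_sq hR.le, mul_comm Real.pi] at this
  rw [← this]
  congr 1 with x
  ring_nf

theorem integrable_exp_neg_sq_div_two {R : ℝ} (hR : 0 < R) (c : ℝ) :
    Integrable fun x : ℝ => Real.exp (-(R * (x - c)) ^ 2 / 2) := by
  have := (integrable_exp_neg_mul_sq (b := R ^ 2 / 2) (by positivity)).comp_sub_right c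
  refine this.congr (Filter.Eventually.of_forall fun x => ?_)
  simp only
  ring_nf

theorem hasDerivAt_rpow_sq_add {h : ℝ} (hh : 0 < h) (β r : ℝ) :
    HasDerivAt (fun r : ℝ => (r ^ 2 + h ^ 2) ^ (-β))
      (-(2 * β * r * (r ^ 2 + h ^ 2) ^ (-β - 1))) r := by
  have h1 : HasDerivAt (fun r : ℝ => r ^ 2 + h ^ 2) (2 * r) r := by
    simpa using ((hasDerivAt_pow 2 r).add_const (h ^ 2))
  convert! h1.rpow_const (p := -β) (Or.inl (by positivity)) using 1
  ring

theorem injOn_rpow_sq_add {h β : ℝ} (hh : 0 < h) (hβ : 0 < β) :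
    InjOn (fun r : ℝ => (r ^ 2 + h ^ 2) ^ (-β)) (Ici 0) := by
  intro r hr s hs e
  have := (Real.rpow_left_inj (by positivity) (by positivity) (neg_ne_zero.2 hβ.ne')).1 e
  exact (pow_left_inj₀ hr hs two_ne_zero).1 (by linarith)

/-- The image of Lebesgue measure on a disc under the path loss has a bounded density; here in
terms of Gaussian averages. -/
theorem exists_setIntegral_exp_pathLoss_le {h β : ℝ} (hh : 0 < h) (hβ : 0 < β) (ρ : ℝ) :
    ∃ C : ℝ, ∀ R : ℝ, 0 < R → ∀ c : ℝ,
      ∫ x in Metric.ball (0 : VLC.Plane) ρ,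
        Real.exp (-(R * ((‖x‖ ^ 2 + h ^ 2) ^ (-β) - c)) ^ 2 / 2) ≤ C / R := by
  set g : ℝ → ℝ := fun r => (r ^ 2 + h ^ 2) ^ (-β) with hg
  set g' : ℝ → ℝ := fun r => -(2 * β * r * (r ^ 2 + h ^ 2) ^ (-β - 1)) with hg'
  -- Chosen so that `m * r ≤ |g' r|` on `(0, ρ)`. Although `g'` vanishes at `0`, the polar Jacobian
  -- `r` vanishes equally fast, which is why the density stays bounded.
  set m : ℝ := 2 * β * (ρ ^ 2 + h ^ 2) ^ (-β - 1) with hm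
  have hm0 : 0 < m := by positivity
  set V : ℝ := (volume : Measure VLC.Plane).real (Metric.ball 0 1) with hV
  refine ⟨2 * V * (m⁻¹ * √(2 * Real.pi)), fun R hR c => ?_⟩
  set E : ℝ → ℝ := fun s => Real.exp (-(R * (s - c)) ^ 2 / 2) with hE
  have hderiv : ∀ r ∈ Ioo 0 ρ, HasDerivWithinAt g (g' r) (Ioo 0 ρ) r := fun r _ =>
    (hasDerivAt_rpow_sq_add hh β r).hasDerivWithinAt
  have hinj : InjOn g (Ioo 0 ρ) := (injOn_rpow_sq_add hh hβ).mono fun r hr => hr.1.le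
  have hEi : Integrable E := integrable_exp_neg_sq_div_two hR c
  have hi : IntegrableOn (fun r => |g' r| • E (g r)) (Ioo 0 ρ) :=
    (integrableOn_image_iff_integrableOn_abs_deriv_smul measurableSet_Ioo hderiv hinj E).1
      hEi.integrableOn
  have h1 : ∫ r in Ioo 0 ρ, |g' r| • E (g r) ≤ √(2 * Real.pi) / R := by
    rw [← integral_image_eq_integral_abs_deriv_smul measurableSet_Ioo hderiv hinj,
      ← integral_exp_neg_sq_div_two hR c]
    exact setIntegral_le_integral hEi (Filter.Eventually.of_forall fun x => Real.exp_nonneg _)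
  have h2 : ∫ r in Ioo 0 ρ, r * E (g r) ≤ m⁻¹ * (√(2 * Real.pi) / R) := by
    refine le_trans ?_ (mul_le_mul_of_nonneg_left h1 (inv_nonneg.2 hm0.le))
    rw [← integral_const_mul]
    refine integral_mono_of_nonneg ?_ (hi.const_mul _) ?_
    · filter_upwards [ae_restrict_mem measurableSet_Ioo] with r hr
      exact mul_nonneg hr.1.le (Real.exp_nonneg _)
    · filter_upwards [ae_restrict_mem measurableSet_Ioo] with r hr
      have hr0 := hr.1
      simp only [smul_eq_mul]
      rw [← mul_assoc]
      refine mul_le_mul_of_nonneg_right ?_ (Real.exp_nonneg _)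
      rw [inv_mul_eq_div, le_div_iff₀ hm0, hg', abs_neg, abs_of_nonneg (by positivity), hm]
      have : (ρ ^ 2 + h ^ 2) ^ (-β - 1) ≤ (r ^ 2 + h ^ 2) ^ (-β - 1) := by
        refine Real.rpow_le_rpow_of_nonpos (by positivity) ?_ (by linarith)
        nlinarith [hr.1, hr.2]
      have h3 : 0 ≤ 2 * β * r := by positivity
      nlinarith [mul_le_mul_of_nonneg_left this h3]
  -- Polar coordinates in dimension two; `2 * V` is the length of the unit circle.
  have h3 : ∫ x in Metric.ball (0 : VLC.Plane) ρ, E (g ‖x‖)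
      = 2 * V * ∫ r in Ioo 0 ρ, r * E (g r) := by
    have h4 := integral_fun_norm_addHaar (volume : Measure VLC.Plane)
      ((Iio ρ).indicator fun r => E (g r))
    rw [finrank_euclideanSpace_fin] at h4
    have h5 : (fun x : VLC.Plane => (Iio ρ).indicator (fun r => E (g r)) ‖x‖)
        = (Metric.ball (0 : VLC.Plane) ρ).indicator fun x => E (g ‖x‖) := by
      ext x; simp [indicator]
    have h6 : ∀ r : ℝ, r ^ (2 - 1) • (Iio ρ).indicator (fun r => E (g r)) r
        = (Iio ρ).indicator (fun r => r * E (g r)) r := fun r => by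
      by_cases hr : r < ρ <;> simp [indicator, hr]
    simp_rw [h6] at h4
    rw [h5, integral_indicator measurableSet_ball, setIntegral_indicator measurableSet_Iio,
      Ioi_inter_Iio] at h4
    rw [h4]
    simp [mul_assoc, hV]
  have hV0 : 0 ≤ V := measureReal_nonneg
  calc _ = ∫ x in Metric.ball (0 : VLC.Plane) ρ, E (g ‖x‖) := rfl
    _ ≤ 2 * V * (m⁻¹ * (√(2 * Real.pi) / R)) := by rw [h3]; gcongr
    _ = _ := by ring

/-- The radial profile is injective, so a nonempty level set lies in a sphere about `0`. -/
theorem volume_pathLoss_eq {h β : ℝ} (hh : 0 < h) (hβ : 0 < β) (c : ℝ) :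
    volume {x : VLC.Plane | (‖x‖ ^ 2 + h ^ 2) ^ (-β) = c} = 0 := by
  rcases {x : VLC.Plane | (‖x‖ ^ 2 + h ^ 2) ^ (-β) = c}.eq_empty_or_nonempty with he | ⟨z, hz⟩
  · rw [he, measure_empty]
  · refine measure_mono_null (fun x hx => ?_) (Measure.addHaar_sphere volume (0 : VLC.Plane) ‖z‖)
    rw [mem_sphere_zero_iff_norm]
    exact injOn_rpow_sq_add hh hβ (norm_nonneg x) (norm_nonneg z) (hx.trans hz.symm)

/-! ### Finitely many independent Poisson counts. -/

theorem lintegral_poissonMeasure (r : ℝ≥0) (G : ℕ → ℝ≥0∞) :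
    ∫⁻ n, G n ∂poissonMeasure r
      = ∑' n : ℕ, ENNReal.ofReal (Real.exp (-r) * r ^ n / n.factorial) * G n := by
  rw [poissonMeasure, lintegral_sum_measure]
  simp [lintegral_smul_measure]

/-- The Stein-Chen identity of the Poisson distribution. -/
theorem lintegral_natCast_mul_poissonMeasure (r : ℝ≥0) (G : ℕ → ℝ≥0∞) :
    ∫⁻ n, n * G n ∂poissonMeasure r = r * ∫⁻ n, G (n + 1) ∂poissonMeasure r := by
  -- The term `n = 0` drops out; after the shift, `(n + 1) / (n + 1)!` becomes `1 / n!` and one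
  -- factor `r` is released.
  rw [lintegral_poissonMeasure, lintegral_poissonMeasure, ← ENNReal.tsum_mul_left,
    tsum_eq_zero_add' ENNReal.summable]
  simp only [Nat.cast_zero, zero_mul, mul_zero, zero_add]
  congr 1 with n
  rw [← mul_assoc, ← mul_assoc]
  congr 1
  rw [← ENNReal.ofReal_natCast, ← ENNReal.ofReal_mul (by positivity), ← ENNReal.ofReal_coe_nnreal,
    ← ENNReal.ofReal_mul (by positivity)]
  congr 1
  rw [Nat.factorial_succ]
  push_cast
  field_simp
  ring

section Discrete

variable {Ω ι : Type*} [MeasurableSpace Ω] [Fintype ι] {P : Measure Ω}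
  {N : ι → Ω → ℕ} {m : ι → ℝ≥0}

/-- The discrete Campbell formula: given the other counts, which are independent of `N i`,
Stein-Chen applies to `N i`, and its shift by one cancels the subtracted `u i`. -/
theorem lintegral_poisson_mul_sum (hN : ∀ i, Measurable (N i)) (hind : iIndepFun N P)
    (hlaw : ∀ i, P.map (N i) = poissonMeasure (m i)) (u : ι → ℝ) (i : ι) {F : ℝ → ℝ≥0∞}
    (hF : Measurable F) :
    ∫⁻ ω, N i ω * F (∑ j, N j ω * u j - u i) ∂P = m i * ∫⁻ ω, F (∑ j, N j ω * u j) ∂P := by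
  classical
  have := hind.isProbabilityMeasure
  set T : Ω → ℝ := fun ω => ∑ j ∈ Finset.univ.erase i, N j ω * u j with hT
  have hTm : Measurable T := by
    refine Finset.measurable_sum _ fun j _ => ?_
    have := hN j
    fun_prop
  have hsum : ∀ ω, ∑ j, N j ω * u j = N i ω * u i + T ω := fun ω =>
    (Finset.add_sum_erase _ _ (Finset.mem_univ i)).symm
  have hindep : IndepFun (N i) T P := by
    have h := hind.indepFun_finset {i} (Finset.univ.erase i) (by simp) hN
    have hφ : Measurable fun f : ↥({i} : Finset ι) → ℕ => f ⟨i, by simp⟩ := measurable_pi_apply _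
    have hψ : Measurable fun f : ↥(Finset.univ.erase i) → ℕ => ∑ j, (f j : ℝ) * u j := by fun_prop
    have h2 := h.comp hφ hψ
    convert! h2 using 1
    ext ω
    simp only [hT, Function.comp]
    rw [← Finset.sum_coe_sort]
  have hmap := (indepFun_iff_map_prod_eq_prod_map_map (hN i).aemeasurable hTm.aemeasurable).1 hindep
  rw [hlaw i] at hmap
  have hpm : Measurable fun ω => (N i ω, T ω) := (hN i).prodMk hTm
  have hTP : IsProbabilityMeasure (P.map T) := Measure.isProbabilityMeasure_map hTm.aemeasurable
  have key : ∀ H : ℕ → ℝ → ℝ≥0∞, (∀ n, Measurable (H n)) →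
      ∫⁻ ω, H (N i ω) (T ω) ∂P = ∫⁻ t, ∫⁻ n, H n t ∂poissonMeasure (m i) ∂P.map T := by
    intro H hH
    have hH' : Measurable (uncurry H) := measurable_from_prod_countable_right hH
    refine (lintegral_map hH' hpm).symm.trans ?_
    rw [hmap, lintegral_prod_symm _ hH'.aemeasurable]
    rfl
  simp_rw [hsum]
  rw [key (fun n t => n * F (n * u i + t - u i)) (fun n => by fun_prop),
    key (fun n t => F (n * u i + t)) (fun n => by fun_prop), ← lintegral_const_mul]
  · congr 1 with t
    rw [lintegral_natCast_mul_poissonMeasure]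
    congr 2 with n
    congr 1
    push_cast
    ring
  · simp_rw [lintegral_poissonMeasure]
    exact Measurable.tsum fun n => by fun_prop

theorem charFun_sum_poisson (hN : ∀ i, Measurable (N i)) (hind : iIndepFun N P)
    (hlaw : ∀ i, P.map (N i) = poissonMeasure (m i)) (u : ι → ℝ) (t : ℝ) :
    ∫ ω, Complex.exp (((∑ j, N j ω * u j : ℝ) : ℂ) * t * Complex.I) ∂P
      = Complex.exp (∑ j, (m j : ℂ) * (Complex.exp (u j * t * Complex.I) - 1)) := by
  have hXm : ∀ j, Measurable fun ω => (N j ω : ℝ) * u j := fun j => by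
    have := hN j
    fun_prop
  have hX : iIndepFun (fun j ω => (N j ω : ℝ) * u j) P :=
    hind.comp (fun j (n : ℕ) => (n : ℝ) * u j) fun j => by fun_prop
  have h := congrFun (hX.charFun_map_fun_sum_eq_prod fun j => (hXm j).aemeasurable) t
  rw [charFun_apply_real, integral_map (Finset.measurable_sum _ fun j _ => hXm j).aemeasurable
    (by fun_prop : Continuous fun x : ℝ =>
      Complex.exp (t * x * Complex.I)).aestronglyMeasurable, Finset.prod_apply] at h
  rw [Complex.exp_sum]
  calc _ = ∫ ω, Complex.exp (t * ((∑ j, N j ω * u j : ℝ) : ℂ) * Complex.I) ∂P := by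
        simp_rw [mul_comm (t : ℂ)]
    _ = _ := h
    _ = _ := by
      congr 1 with j
      have e : (fun ω => (N j ω : ℝ) * u j) = fun ω => u j * (N j ω : ℝ) := by
        ext; ring
      have e2 : P.map (fun ω => (N j ω : ℝ)) = (poissonMeasure (m j)).map (Nat.cast : ℕ → ℝ) := by
        rw [← hlaw j, Measure.map_map (by fun_prop) (hN j)]
        rfl
      rw [e, charFun_map_mul_comp (by have := hN j; fun_prop), e2, charFun_map_cast_poissonMeasure]
      push_cast
      rfl

end Discrete

/-! ### Discretization of bounded marks. -/

/-- The cells are the level sets of `⌊(n + 1) g⌋`, finitely many as `g` is bounded; `u` and `d` are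
the upper and lower ends of each cell. Both are kept because the interference must be overestimated
and the signal underestimated. -/
theorem exists_discretization {α : Type*} [MeasurableSpace α] {g : α → ℝ} (hg : Measurable g)
    {M : ℝ} (hg0 : ∀ x, 0 ≤ g x) (hgM : ∀ x, g x ≤ M) :
    ∃ (K : ℕ → ℕ) (κ : ∀ n, α → Fin (K n)) (u d : ∀ n, Fin (K n) → ℝ),
      (∀ n, Measurable (κ n)) ∧ (∀ n x, g x ≤ u n (κ n x)) ∧ (∀ n x, d n (κ n x) ≤ g x) ∧
      (∀ x, Filter.Tendsto (fun n => u n (κ n x)) Filter.atTop (nhds (g x))) ∧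
      (∀ x, Filter.Tendsto (fun n => d n (κ n x)) Filter.atTop (nhds (g x))) := by
  -- `Fin.ofNat` reduces modulo the size; the bound `M` ensures that nothing wraps around.
  have hv : ∀ (n : ℕ) x, ((Fin.ofNat (⌊((n : ℝ) + 1) * M⌋₊ + 1) ⌊((n : ℝ) + 1) * g x⌋₊ :
      Fin (⌊((n : ℝ) + 1) * M⌋₊ + 1)) : ℕ) = ⌊((n : ℝ) + 1) * g x⌋₊ := fun n x => by
    refine Nat.mod_eq_of_lt (Nat.lt_succ_of_le (Nat.floor_le_floor ?_))
    exact mul_le_mul_of_nonneg_left (hgM x) (by positivity)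
  have hn : ∀ n : ℕ, (0 : ℝ) < (n : ℝ) + 1 := fun n => by positivity
  have hu : ∀ (n : ℕ) x, g x ≤ ((⌊((n : ℝ) + 1) * g x⌋₊ : ℝ) + 1) / ((n : ℝ) + 1) := fun n x => by
    rw [le_div_iff₀ (hn n), mul_comm]
    exact (Nat.lt_floor_add_one _).le
  have hd : ∀ (n : ℕ) x, (⌊((n : ℝ) + 1) * g x⌋₊ : ℝ) / ((n : ℝ) + 1) ≤ g x := fun n x => by
    rw [div_le_iff₀ (hn n), mul_comm (g x)]
    exact Nat.floor_le (mul_nonneg (hn n).le (hg0 x))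
  have ht := tendsto_one_div_add_atTop_nhds_zero_nat (𝕜 := ℝ)
  refine ⟨fun n => ⌊((n : ℝ) + 1) * M⌋₊ + 1, fun n x => Fin.ofNat _ ⌊((n : ℝ) + 1) * g x⌋₊,
    fun n i => ((i : ℕ) + 1) / ((n : ℝ) + 1), fun n i => (i : ℕ) / ((n : ℝ) + 1), fun n => ?_,
    fun n x => ?_, fun n x => ?_, fun x => ?_, fun x => ?_⟩
  · exact (measurable_from_top (f := Fin.ofNat _)).comp
      (Nat.measurable_floor.comp (hg.const_mul ((n : ℝ) + 1)))
  · simpa only [hv] using hu n x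
  · simpa only [hv] using hd n x
  · simp_rw [hv]
    refine tendsto_of_tendsto_of_tendsto_of_le_of_le tendsto_const_nhds
      (by simpa only [add_zero] using ht.const_add (g x)) (fun n => hu n x) fun n => ?_
    rw [add_div]
    exact add_le_add_left (hd n x) _
  · simp_rw [hv]
    refine tendsto_of_tendsto_of_tendsto_of_le_of_le
      (by simpa only [sub_zero] using ht.const_sub (g x)) tendsto_const_nhds (fun n => ?_) fun n => hd n x
    have := hu n x
    rw [add_div] at this
    simp only
    linarith

theorem sum_encard_fiber {α R : Type*} [Semiring R] {φ : Set α} (hφ : φ.Finite) {K : ℕ}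
    (κ : α → Fin K) (f : Fin K → R) :
    ∑ j, ((φ ∩ κ ⁻¹' {j}).encard.toNat : R) * f j = ∑ x ∈ hφ.toFinset, f (κ x) := by
  classical
  rw [← Finset.sum_fiberwise hφ.toFinset κ]
  refine Finset.sum_congr rfl fun j _ => ?_
  have : φ ∩ κ ⁻¹' {j} = ((hφ.toFinset.filter fun x => κ x = j : Finset α) : Set α) := by
    ext x; simp
  rw [this, Set.encard_coe_eq_coe_finsetCard, ENat.toNat_natCast,
    Finset.sum_congr rfl (g := fun _ => f j), Finset.sum_const, nsmul_eq_mul]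
  intro x hx
  rw [(Finset.mem_filter.1 hx).2]

/-- Approach from above is what saves the case `D' = 0`, where the indicator of the open half-line
is discontinuous. -/
theorem tendsto_indicator_Iio_of_ge {D : ℕ → ℝ} {D' : ℝ}
    (hD : Filter.Tendsto D Filter.atTop (nhds D')) (h : ∀ n, D' ≤ D n) :
    Filter.Tendsto (fun n => (Iio (0 : ℝ)).indicator (1 : ℝ → ℝ≥0∞) (D n)) Filter.atTop
      (nhds ((Iio (0 : ℝ)).indicator (1 : ℝ → ℝ≥0∞) D')) := by
  refine tendsto_const_nhds.congr' ?_
  rcases lt_or_ge D' 0 with h0 | h0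
  · filter_upwards [hD.eventually_lt_const h0] with n hn
    simp [h0, hn]
  · refine Filter.Eventually.of_forall fun n => ?_
    simp [h0, h0.trans (h n)]

/-! ### Shot noise of a Poisson process with finite intensity. -/

section Poisson

variable {Ω : Type*} [MeasurableSpace Ω] {Φ : Ω → Set VLC.Plane} {Λ : Measure VLC.Plane}
  {P : Measure Ω}

theorem VLC.IsPoissonProcess.map_toNat [IsFiniteMeasure Λ]
    (hΦ : VLC.IsPoissonProcess Φ Λ P) {B : Set VLC.Plane}
    (hB : MeasurableSet B) :
    P.map (fun ω => (Φ ω ∩ B).encard.toNat) = poissonMeasure (Λ B).toNNReal := by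
  have h := congrArg (Measure.map ENat.toNat) (hΦ.law_count B hB (measure_ne_top Λ B))
  rw [Measure.map_map measurable_from_top (hΦ.measurable_count B hB),
    Measure.map_map measurable_from_top measurable_from_top] at h
  have e : ENat.toNat ∘ (fun n : ℕ => (n : ℕ∞)) = id := by ext; simp
  rw [e, Measure.map_id] at h
  exact h

theorem VLC.IsPoissonProcess.measurable_toNat (hΦ : VLC.IsPoissonProcess Φ Λ P)
    {B : Set VLC.Plane} (hB : MeasurableSet B) :
    Measurable fun ω => (Φ ω ∩ B).encard.toNat :=
  measurable_from_top.comp (hΦ.measurable_count B hB)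

/-- The total count has a Poisson law, which gives no mass to `⊤`. -/
theorem VLC.IsPoissonProcess.ae_finite [IsFiniteMeasure Λ] (hΦ : VLC.IsPoissonProcess Φ Λ P) :
    ∀ᵐ ω ∂P, (Φ ω).Finite := by
  have h := hΦ.law_count univ .univ (measure_ne_top Λ _)
  have h2 := congrArg (fun μ => μ {(⊤ : ℕ∞)}) h
  beta_reduce at h2
  rw [Measure.map_apply (hΦ.measurable_count _ .univ) (measurableSet_singleton _),
    Measure.map_apply measurable_from_top (measurableSet_singleton _)] at h2
  have e : (fun n : ℕ => (n : ℕ∞)) ⁻¹' {⊤} = ∅ := by ext; simp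
  rw [e, measure_empty] at h2
  rw [ae_iff]
  convert! h2 using 2
  ext ω
  simp [Set.encard_eq_top_iff]

theorem VLC.IsPoissonProcess.iIndepFun_toNat (hΦ : VLC.IsPoissonProcess Φ Λ P) {K : ℕ}
    {κ : VLC.Plane → Fin K} (hκ : Measurable κ) :
    iIndepFun (fun j ω => (Φ ω ∩ κ ⁻¹' {j}).encard.toNat) P := by
  refine (hΦ.indep_count K (fun j => κ ⁻¹' {j}) (fun j => hκ (measurableSet_singleton j))
    fun i j hij => ?_).comp (fun _ => ENat.toNat) fun _ => measurable_from_top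
  exact Disjoint.preimage _ (by simpa using hij)

/-- The sum of `g` over a finite set, as a limit of discretized sums. -/
theorem tendsto_sum_encard_fiber {g : VLC.Plane → ℝ}
    {K : ℕ → ℕ} {κ : ∀ n, VLC.Plane → Fin (K n)} {u : ∀ n, Fin (K n) → ℝ}
    (hu : ∀ x, Filter.Tendsto (fun n => u n (κ n x)) Filter.atTop (nhds (g x)))
    {φ : Set VLC.Plane} (hφ : φ.Finite) :
    Filter.Tendsto (fun n => ∑ j, ((φ ∩ κ n ⁻¹' {j}).encard.toNat : ℝ) * u n j) Filter.atTop
      (nhds (∑ᶠ x ∈ φ, g x)) := by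
  rw [finsum_mem_eq_finite_toFinset_sum _ hφ]
  simp_rw [sum_encard_fiber hφ]
  exact tendsto_finsetSum _ fun x _ => hu x

theorem VLC.IsPoissonProcess.measurable_sum_fiber (hΦ : VLC.IsPoissonProcess Φ Λ P) {K : ℕ}
    {κ : VLC.Plane → Fin K} (hκ : Measurable κ) (u : Fin K → ℝ) :
    Measurable fun ω => ∑ j, ((Φ ω ∩ κ ⁻¹' {j}).encard.toNat : ℝ) * u j :=
  Finset.measurable_sum _ fun j _ => by
    have := hΦ.measurable_toNat (hκ (measurableSet_singleton j))
    fun_prop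

/-- Only counts are known to be measurable; the sum is an almost sure limit of finite combinations
of counts. -/
theorem VLC.IsPoissonProcess.aemeasurable_finsum [IsFiniteMeasure Λ]
    (hΦ : VLC.IsPoissonProcess Φ Λ P)
    {g : VLC.Plane → ℝ} (hg : Measurable g) {M : ℝ} (hg0 : ∀ x, 0 ≤ g x) (hgM : ∀ x, g x ≤ M) :
    AEMeasurable (fun ω => ∑ᶠ x ∈ Φ ω, g x) P := by
  obtain ⟨K, κ, u, -, hκ, -, -, hu, -⟩ := exists_discretization hg hg0 hgM
  refine aemeasurable_of_tendsto_metrizable_ae Filter.atTop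
    (fun n => (hΦ.measurable_sum_fiber (hκ n) (u n)).aemeasurable) ?_
  filter_upwards [hΦ.ae_finite] with ω hω
  exact tendsto_sum_encard_fiber hu hω

theorem integral_comp_fin {α : Type*} [MeasurableSpace α] (Λ : Measure α) [IsFiniteMeasure Λ]
    {K : ℕ} {κ : α → Fin K} (hκ : Measurable κ) (f : Fin K → ℂ) :
    ∫ x, f (κ x) ∂Λ = ∑ j, ((Λ (κ ⁻¹' {j})).toNNReal : ℂ) * f j := by
  rw [← integral_map (f := f) hκ.aemeasurable .of_discrete, integral_fintype .of_finite]
  congr 1 with j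
  rw [measureReal_def, Measure.map_apply hκ (measurableSet_singleton j), Complex.real_smul]
  rfl

theorem lintegral_comp_fin {α : Type*} [MeasurableSpace α] (Λ : Measure α) [IsFiniteMeasure Λ]
    {K : ℕ} {κ : α → Fin K} (hκ : Measurable κ) (f : Fin K → ℝ≥0∞) :
    ∫⁻ x, f (κ x) ∂Λ = ∑ j, ((Λ (κ ⁻¹' {j})).toNNReal : ℝ≥0∞) * f j := by
  rw [← lintegral_map (f := f) measurable_from_top hκ, lintegral_fintype]
  congr 1 with j
  rw [Measure.map_apply hκ (measurableSet_singleton j), ENNReal.coe_toNNReal (measure_ne_top _ _),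
    mul_comm]

/-- The characteristic function of shot noise. -/
theorem VLC.IsPoissonProcess.charFun_finsum [IsFiniteMeasure Λ] [IsProbabilityMeasure P]
    (hΦ : VLC.IsPoissonProcess Φ Λ P)
    {g : VLC.Plane → ℝ} (hg : Measurable g) {M : ℝ} (hg0 : ∀ x, 0 ≤ g x) (hgM : ∀ x, g x ≤ M)
    (t : ℝ) :
    charFun (P.map fun ω => ∑ᶠ x ∈ Φ ω, g x) t
      = Complex.exp (∫ x, (Complex.exp (g x * t * Complex.I) - 1) ∂Λ) := by
  obtain ⟨K, κ, u, -, hκ, -, -, hu, -⟩ := exists_discretization hg hg0 hgM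
  have hc : Continuous fun s : ℝ => Complex.exp (s * t * Complex.I) := by fun_prop
  have hn1 : ∀ s : ℝ, ‖Complex.exp (s * t * Complex.I)‖ = 1 := fun s => by
    rw [← Complex.ofReal_mul, Complex.norm_exp_ofReal_mul_I]
  have l1 : Filter.Tendsto (fun n => ∫ ω, Complex.exp
      (((∑ j, ((Φ ω ∩ κ n ⁻¹' {j}).encard.toNat : ℝ) * u n j : ℝ) : ℂ) * t * Complex.I) ∂P)
      Filter.atTop (nhds (∫ ω, Complex.exp (((∑ᶠ x ∈ Φ ω, g x : ℝ) : ℂ) * t * Complex.I) ∂P)) := by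
    refine tendsto_integral_of_dominated_convergence (fun _ => 1) (fun n => ?_)
      (integrable_const _) (fun n => Filter.Eventually.of_forall fun ω => (hn1 _).le) ?_
    · exact (hc.measurable.comp (hΦ.measurable_sum_fiber (hκ n) (u n))).aestronglyMeasurable
    · filter_upwards [hΦ.ae_finite] with ω hω
      exact (hc.tendsto _).comp (tendsto_sum_encard_fiber hu hω)
  have l2 : Filter.Tendsto (fun n => Complex.exp
      (∫ x, (Complex.exp (u n (κ n x) * t * Complex.I) - 1) ∂Λ)) Filter.atTop
      (nhds (Complex.exp (∫ x, (Complex.exp (g x * t * Complex.I) - 1) ∂Λ))) := by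
    refine Filter.Tendsto.cexp (tendsto_integral_of_dominated_convergence (fun _ => 2)
      (fun n => ?_) (integrable_const _) (fun n => Filter.Eventually.of_forall fun x => ?_)
      (Filter.Eventually.of_forall fun x => ?_))
    · have : Measurable fun i : Fin (K n) => Complex.exp (u n i * t * Complex.I) - 1 :=
        measurable_from_top
      exact (this.comp (hκ n)).aestronglyMeasurable
    · refine (norm_sub_le _ _).trans ?_
      rw [hn1, norm_one]
      norm_num
    · exact ((hc.tendsto _).comp (hu x)).sub_const 1
  have e : ∀ n, ∫ ω, Complex.exp
      (((∑ j, ((Φ ω ∩ κ n ⁻¹' {j}).encard.toNat : ℝ) * u n j : ℝ) : ℂ) * t * Complex.I) ∂P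
      = Complex.exp (∫ x, (Complex.exp (u n (κ n x) * t * Complex.I) - 1) ∂Λ) := fun n => by
    rw [charFun_sum_poisson (fun j => hΦ.measurable_toNat (hκ n (measurableSet_singleton j)))
      (hΦ.iIndepFun_toNat (hκ n)) (fun j => hΦ.map_toNat (hκ n (measurableSet_singleton j))),
      integral_comp_fin Λ (hκ n) fun i => Complex.exp (u n i * t * Complex.I) - 1]
  simp_rw [e] at l1
  rw [← tendsto_nhds_unique l1 l2, charFun_apply_real,
    integral_map (hΦ.aemeasurable_finsum hg hg0 hgM) (by fun_prop : Continuous fun x : ℝ =>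
      Complex.exp (t * x * Complex.I)).aestronglyMeasurable]
  simp_rw [mul_comm (t : ℂ)]

theorem VLC.IsPoissonProcess.integrable_finsum [IsFiniteMeasure Λ]
    (hΦ : VLC.IsPoissonProcess Φ Λ P)
    {g : VLC.Plane → ℝ} (hg : Measurable g) {M : ℝ} (hg0 : ∀ x, 0 ≤ g x) (hgM : ∀ x, g x ≤ M) :
    Integrable (fun ω => ∑ᶠ x ∈ Φ ω, g x) P := by
  have hm := hΦ.measurable_toNat (B := univ) .univ
  have h1 : Integrable (fun ω => ((Φ ω ∩ univ).encard.toNat : ℝ)) P := by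
    refine ⟨(by fun_prop : Measurable _).aestronglyMeasurable, ?_⟩
    -- The Poisson mean is Stein-Chen for the constant function `1`.
    have h2 : ∫⁻ ω, ((Φ ω ∩ univ).encard.toNat : ℝ≥0∞) ∂P = (Λ univ).toNNReal := by
      rw [← lintegral_map (f := fun n : ℕ => (n : ℝ≥0∞)) measurable_from_top hm, hΦ.map_toNat .univ]
      simpa using lintegral_natCast_mul_poissonMeasure (Λ univ).toNNReal 1
    rw [HasFiniteIntegral]
    simp only [Real.enorm_natCast]
    rw [h2]
    exact ENNReal.coe_lt_top
  refine (h1.const_mul M).mono' (hΦ.aemeasurable_finsum hg hg0 hgM).aestronglyMeasurable ?_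
  filter_upwards [hΦ.ae_finite] with ω hω
  rw [finsum_mem_eq_finite_toFinset_sum _ hω, Real.norm_eq_abs,
    abs_of_nonneg (Finset.sum_nonneg fun x _ => hg0 x), inter_univ,
    hω.encard_eq_coe_toFinset_card, ENat.toNat_natCast, mul_comm, ← nsmul_eq_mul]
  exact Finset.sum_le_card_nsmul _ _ _ fun x _ => hgM x

end Poisson

/-! ### The coverage event and the reduced Campbell formula. -/

section Coverage

/-- A point whose mark exceeds all the others together has the largest mark. -/
theorem lt_of_finsum_sub_add_lt {α : Type*} {φ : Set α} (hφ : φ.Finite) {g : α → ℝ}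
    (hg : ∀ x, 0 ≤ g x) {s τ : ℝ} (hs : 0 ≤ s) (hτ : 1 ≤ τ) {x z : α} (hx : x ∈ φ) (hz : z ∈ φ)
    (hxz : x ≠ z) (h : ∑ᶠ w ∈ φ, g w - g x + s - g x / τ < 0) : g z < g x := by
  classical
  rw [finsum_mem_eq_finite_toFinset_sum _ hφ] at h
  have h1 : g x + g z ≤ ∑ w ∈ hφ.toFinset, g w := by
    rw [← Finset.sum_pair hxz]
    refine Finset.sum_le_sum_of_subset_of_nonneg ?_ fun w _ _ => hg w
    intro w hw
    rcases Finset.mem_insert.1 hw with rfl | hw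
    · simpa using hx
    · rw [Finset.mem_singleton.1 hw]; simpa using hz
  have := div_le_self (hg x) hτ
  linarith

theorem sum_indicator_eq_indicator_exists {α : Type*} {φ : Set α} (hφ : φ.Finite) {D : α → ℝ}
    (hD : ∀ x ∈ φ, ∀ z ∈ φ, D x < 0 → D z < 0 → x = z) :
    ∑ x ∈ hφ.toFinset, (Iio (0 : ℝ)).indicator (1 : ℝ → ℝ≥0∞) (D x)
      = {ψ : Set α | ∃ x ∈ ψ, D x < 0}.indicator 1 φ := by
  by_cases h : ∃ x ∈ φ, D x < 0
  · obtain ⟨x, hx, hx0⟩ := h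
    rw [Finset.sum_eq_single_of_mem x (by simpa using hx)]
    · rw [indicator_of_mem (mem_Iio.2 hx0),
        indicator_of_mem (show φ ∈ {ψ : Set α | ∃ x ∈ ψ, D x < 0} from ⟨x, hx, hx0⟩)]
      rfl
    · intro z hz hzx
      refine indicator_of_notMem (fun hz0 => hzx ?_) _
      exact hD z (by simpa using hz) x hx hz0 hx0
  · rw [indicator_of_notMem (show φ ∉ {ψ : Set α | ∃ x ∈ ψ, D x < 0} from h)]
    refine Finset.sum_eq_zero fun x hx => indicator_of_notMem (s := Iio (0 : ℝ))
      (fun hx0 => h ⟨x, by simpa using hx, hx0⟩) _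

variable {Ω : Type*} [MeasurableSpace Ω] {Φ : Ω → Set VLC.Plane} {Λ : Measure VLC.Plane}
  {P : Measure Ω}

/-- The reduced Campbell formula for a function of the total mark. -/
theorem VLC.IsPoissonProcess.measure_exists_lt [IsFiniteMeasure Λ] [IsProbabilityMeasure P]
    (hΦ : VLC.IsPoissonProcess Φ Λ P) {g : VLC.Plane → ℝ} (hg : Measurable g) {M : ℝ}
    (hg0 : ∀ x, 0 ≤ g x) (hgM : ∀ x, g x ≤ M) {s τ : ℝ} (hs : 0 ≤ s) (hτ : 1 ≤ τ) :
    P {ω | ∃ x ∈ Φ ω, ∑ᶠ w ∈ Φ ω, g w - g x + s - g x / τ < 0}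
      = ∫⁻ x, P {ω | ∑ᶠ w ∈ Φ ω, g w + s - g x / τ < 0} ∂Λ := by
  obtain ⟨K, κ, u, d, hκ, hgu, hdg, hu, hd⟩ := exists_discretization hg hg0 hgM
  have hτ0 : 0 < τ := one_pos.trans_le hτ
  set ind : ℝ → ℝ≥0∞ := (Iio (0 : ℝ)).indicator 1 with hind
  have hindm : Measurable ind := measurable_one.indicator measurableSet_Iio
  have hind1 : ∀ r, ind r ≤ 1 := fun r => indicator_le_self' (fun _ _ => zero_le_one) r
  have hJ := hΦ.aemeasurable_finsum hg hg0 hgM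
  set S : ∀ n, Ω → ℝ := fun n ω => ∑ j, ((Φ ω ∩ κ n ⁻¹' {j}).encard.toNat : ℝ) * u n j with hS
  have hSm : ∀ n, Measurable (S n) := fun n => hΦ.measurable_sum_fiber (hκ n) (u n)
  have hSsum : ∀ n {φ : Set VLC.Plane} (hφ : φ.Finite),
      ∑ j, ((φ ∩ κ n ⁻¹' {j}).encard.toNat : ℝ) * u n j = ∑ x ∈ hφ.toFinset, u n (κ n x) :=
    fun n φ hφ => sum_encard_fiber hφ (κ n) (u n)
  have hSJ : ∀ᵐ ω ∂P, (∀ n, ∑ᶠ w ∈ Φ ω, g w ≤ S n ω) ∧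
      Filter.Tendsto (fun n => S n ω) Filter.atTop (nhds (∑ᶠ w ∈ Φ ω, g w)) := by
    filter_upwards [hΦ.ae_finite] with ω hω
    refine ⟨fun n => ?_, tendsto_sum_encard_fiber hu hω⟩
    simp only [hS]
    rw [hSsum n hω, finsum_mem_eq_finite_toFinset_sum _ hω]
    exact Finset.sum_le_sum fun x _ => hgu n x
  -- The number of points that pass the discretized test. The own mark is removed at the rounded-up
  -- value with which it enters `S n`, while the signal is rounded down, so the tested quantity
  -- dominates the exact one and converges to it from above.
  set W : ℕ → Ω → ℝ≥0∞ := fun n ω => ∑ j, ((Φ ω ∩ κ n ⁻¹' {j}).encard.toNat : ℝ≥0∞) *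
    ind (S n ω - u n j + s - d n j / τ) with hW
  have hWsum : ∀ n ω (hω : (Φ ω).Finite), W n ω = ∑ x ∈ hω.toFinset,
      ind (S n ω - u n (κ n x) + s - d n (κ n x) / τ) := fun n ω hω =>
    sum_encard_fiber hω (κ n) fun j => ind (S n ω - u n j + s - d n j / τ)
  have hle : ∀ n {φ : Set VLC.Plane} (hφ : φ.Finite) (x : VLC.Plane), x ∈ φ →
      ∑ᶠ w ∈ φ, g w - g x + s - g x / τ ≤
        ∑ j, ((φ ∩ κ n ⁻¹' {j}).encard.toNat : ℝ) * u n j - u n (κ n x) + s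
          - d n (κ n x) / τ := by
    classical
    intro n φ hφ x hx
    have h1 : ∑ᶠ w ∈ φ, g w - g x ≤
        ∑ j, ((φ ∩ κ n ⁻¹' {j}).encard.toNat : ℝ) * u n j - u n (κ n x) := by
      rw [hSsum n hφ, finsum_mem_eq_finite_toFinset_sum _ hφ]
      have hx' : x ∈ hφ.toFinset := by simpa using hx
      rw [← Finset.add_sum_erase _ _ hx', ← Finset.add_sum_erase _ (fun x => u n (κ n x)) hx',
        add_sub_cancel_left, add_sub_cancel_left]
      exact Finset.sum_le_sum fun x _ => hgu n x
    have h2 : d n (κ n x) / τ ≤ g x / τ := by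
      have := hdg n x
      gcongr
    linarith
  have hexcl : ∀ {φ : Set VLC.Plane} (_ : φ.Finite), ∀ x ∈ φ, ∀ z ∈ φ,
      ∑ᶠ w ∈ φ, g w - g x + s - g x / τ < 0 → ∑ᶠ w ∈ φ, g w - g z + s - g z / τ < 0 → x = z := by
    intro φ hφ x hx z hz h1 h2
    by_contra hxz
    exact lt_asymm (lt_of_finsum_sub_add_lt hφ hg0 hs hτ hx hz hxz h1)
      (lt_of_finsum_sub_add_lt hφ hg0 hs hτ hz hx (Ne.symm hxz) h2)
  set E : Set Ω := {ω | ∃ x ∈ Φ ω, ∑ᶠ w ∈ Φ ω, g w - g x + s - g x / τ < 0} with hE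
  have hEsum : ∀ ω (hω : (Φ ω).Finite), ∑ x ∈ hω.toFinset,
      ind (∑ᶠ w ∈ Φ ω, g w - g x + s - g x / τ) = E.indicator 1 ω := fun ω hω =>
    sum_indicator_eq_indicator_exists hω (hexcl hω)
  have hWE : ∀ᵐ ω ∂P, Filter.Tendsto (fun n => W n ω) Filter.atTop (nhds (E.indicator 1 ω)) := by
    filter_upwards [hΦ.ae_finite, hSJ] with ω hω hSω
    simp_rw [hWsum _ ω hω]
    rw [← hEsum ω hω]
    refine tendsto_finsetSum _ fun x hx => tendsto_indicator_Iio_of_ge ?_ fun n =>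
      hle n hω x (by simpa using hx)
    exact ((hSω.2.sub (hu x)).add_const s).sub ((hd x).div_const τ)
  -- The discretized test is stricter than the exact one, which at most one point passes.
  have hW1 : ∀ n, ∀ᵐ ω ∂P, W n ω ≤ 1 := fun n => by
    filter_upwards [hΦ.ae_finite] with ω hω
    rw [hWsum n ω hω]
    calc _ ≤ ∑ x ∈ hω.toFinset, ind (∑ᶠ w ∈ Φ ω, g w - g x + s - g x / τ) := by
          refine Finset.sum_le_sum fun x hx => ?_
          by_cases h0 : S n ω - u n (κ n x) + s - d n (κ n x) / τ < 0
          · refine (hind1 _).trans_eq (Eq.symm ?_)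
            exact indicator_of_mem (mem_Iio.2
              ((hle n hω x (by simpa using hx)).trans_lt h0)) _
          · rw [hind, indicator_of_notMem (s := Iio (0 : ℝ)) h0]
            exact zero_le
      _ ≤ 1 := by
          rw [hEsum ω hω]
          exact indicator_le_self' (fun _ _ => zero_le_one) ω
  have hWm : ∀ n, Measurable (W n) := fun n => Finset.measurable_sum _ fun j _ => by
    have := hΦ.measurable_toNat (hκ n (measurableSet_singleton j))
    have := hSm n
    fun_prop
  -- Measurability of the event is not assumed; its indicator is an almost sure limit of the
  -- measurable `W n`.
  have hEm : NullMeasurableSet E P := by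
    have h1 : AEMeasurable (E.indicator (1 : Ω → ℝ≥0∞)) P :=
      aemeasurable_of_tendsto_metrizable_ae Filter.atTop (fun n => (hWm n).aemeasurable) hWE
    exact (aemeasurable_indicator_const_iff (1 : ℝ≥0∞)).1 h1
  have l1 : Filter.Tendsto (fun n => ∫⁻ ω, W n ω ∂P) Filter.atTop (nhds (P E)) := by
    rw [← lintegral_indicator_one₀ hEm]
    exact tendsto_lintegral_of_dominated_convergence' 1 (fun n => (hWm n).aemeasurable) hW1
      (by simp) hWE
  have hWint : ∀ n, ∫⁻ ω, W n ω ∂P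
      = ∫⁻ x, ∫⁻ ω, ind (S n ω + s - d n (κ n x) / τ) ∂P ∂Λ := fun n => by
    rw [lintegral_comp_fin Λ (hκ n) fun j => ∫⁻ ω, ind (S n ω + s - d n j / τ) ∂P, hW,
      lintegral_finsetSum]
    · refine Finset.sum_congr rfl fun j _ => ?_
      exact lintegral_poisson_mul_sum
        (fun j => hΦ.measurable_toNat (hκ n (measurableSet_singleton j)))
        (hΦ.iIndepFun_toNat (hκ n)) (fun j => hΦ.map_toNat (hκ n (measurableSet_singleton j)))
        (u n) j (F := fun r => ind (r + s - d n j / τ)) (by fun_prop)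
    · intro j _
      have := hΦ.measurable_toNat (hκ n (measurableSet_singleton j))
      have := hSm n
      fun_prop
  have l2 : Filter.Tendsto (fun n => ∫⁻ x, ∫⁻ ω, ind (S n ω + s - d n (κ n x) / τ) ∂P ∂Λ)
      Filter.atTop (nhds (∫⁻ x, P {ω | ∑ᶠ w ∈ Φ ω, g w + s - g x / τ < 0} ∂Λ)) := by
    refine tendsto_lintegral_of_dominated_convergence 1 (fun n => ?_)
      (fun n => Filter.Eventually.of_forall fun x => ?_) (by simp)
      (Filter.Eventually.of_forall fun x => ?_)
    · have : Measurable fun j => ∫⁻ ω, ind (S n ω + s - d n j / τ) ∂P := measurable_from_top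
      exact this.comp (hκ n)
    · exact (lintegral_mono fun ω => hind1 _).trans (by simp)
    · have hm : NullMeasurableSet {ω | ∑ᶠ w ∈ Φ ω, g w + s - g x / τ < 0} P :=
        ((hJ.add_const s).sub_const (g x / τ)).nullMeasurableSet_preimage measurableSet_Iio
      rw [← lintegral_indicator_one₀ hm]
      refine tendsto_lintegral_of_dominated_convergence' 1 (fun n => ?_)
        (fun n => Filter.Eventually.of_forall fun ω => hind1 _) (by simp) ?_
      · have := hSm n
        fun_prop
      · filter_upwards [hSJ] with ω hω
        refine tendsto_indicator_Iio_of_ge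
          (((hω.2.add_const s)).sub ((hd x).div_const τ)) fun n => ?_
        have h1 := hω.1 n
        have h2 : d n (κ n x) / τ ≤ g x / τ := by
          have := hdg n x
          gcongr
        linarith
  simp_rw [hWint] at l1
  exact tendsto_nhds_unique l1 l2

theorem VLC.interference_eq {h β : ℝ} (y : VLC.Plane) {φ : Set VLC.Plane} (hφ : φ.Finite) :
    VLC.interference h β y φ = ENNReal.ofReal (∑ᶠ x ∈ φ, VLC.pathLoss h β x y) := by
  rw [finsum_mem_eq_finite_toFinset_sum _ hφ, ENNReal.ofReal_sum_of_nonneg]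
  · rw [VLC.interference, ← Finset.tsum_subtype' hφ.toFinset
      (fun x => ENNReal.ofReal (VLC.pathLoss h β x y)), hφ.coe_toFinset]
  · intro x _
    exact Real.rpow_nonneg (by positivity) _

theorem VLC.interference_sdiff_eq {h β : ℝ} (y : VLC.Plane) {φ : Set VLC.Plane} (hφ : φ.Finite)
    {x : VLC.Plane} (hx : x ∈ φ) :
    VLC.interference h β y (φ \ {x})
      = ENNReal.ofReal (∑ᶠ z ∈ φ, VLC.pathLoss h β z y - VLC.pathLoss h β x y) := by
  have h1 := VLC.interference_add h β y φ hx
  rw [VLC.interference_eq y hφ] at h1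
  rw [ENNReal.ofReal_sub _ (show 0 ≤ VLC.pathLoss h β x y from Real.rpow_nonneg (by positivity) _),
    ← h1,
    ENNReal.add_sub_cancel_left ENNReal.ofReal_ne_top]

theorem VLC.lt_sinr_iff {h β σ τ : ℝ} (hh : 0 < h) (hτ : 1 ≤ τ) (y : VLC.Plane)
    {φ : Set VLC.Plane} (hφ : φ.Finite) {x : VLC.Plane} (hx : x ∈ φ) :
    ENNReal.ofReal τ < VLC.sinr h β σ y φ x ↔
      ∑ᶠ z ∈ φ, VLC.pathLoss h β z y - VLC.pathLoss h β x y + σ ^ 2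
        - VLC.pathLoss h β x y / τ < 0 := by
  have hpos : ∀ z, 0 < VLC.pathLoss h β z y := fun z => Real.rpow_pos_of_pos (by positivity) _
  have hτ0 : 0 < τ := one_pos.trans_le hτ
  have hI : 0 ≤ ∑ᶠ z ∈ φ, VLC.pathLoss h β z y - VLC.pathLoss h β x y := by
    rw [finsum_mem_eq_finite_toFinset_sum _ hφ, sub_nonneg]
    exact Finset.single_le_sum (f := fun z => VLC.pathLoss h β z y) (fun z _ => (hpos z).le)
      (by simpa using hx)
  rw [VLC.sinr, VLC.interference_sdiff_eq y hφ hx, ← ENNReal.ofReal_add hI (sq_nonneg σ),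
    ENNReal.lt_div_iff_mul_lt (Or.inr (by simp)) (Or.inl ENNReal.ofReal_ne_top),
    ← ENNReal.ofReal_mul hτ0.le, ENNReal.ofReal_lt_ofReal_iff (hpos x), sub_neg,
    lt_div_iff₀ hτ0, mul_comm]

/-- For `τ ≥ 1`, maximality of the received power need not be required: any point that beats the
threshold has it. -/
theorem VLC.lt_servedSinr_iff {h β σ τ : ℝ} (hh : 0 < h) (hτ : 1 ≤ τ) (y : VLC.Plane)
    {φ : Set VLC.Plane} (hφ : φ.Finite) :
    ENNReal.ofReal τ < VLC.servedSinr h β σ y φ ↔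
      ∃ x ∈ φ, ∑ᶠ z ∈ φ, VLC.pathLoss h β z y - VLC.pathLoss h β x y + σ ^ 2
        - VLC.pathLoss h β x y / τ < 0 := by
  have hpos : ∀ z, 0 ≤ VLC.pathLoss h β z y := fun z => Real.rpow_nonneg (by positivity) _
  constructor
  · intro h1
    simp only [VLC.servedSinr, lt_iSup_iff] at h1
    obtain ⟨x, hx, h2⟩ := h1
    exact ⟨x, hx.1, (VLC.lt_sinr_iff hh hτ y hφ hx.1).1 h2⟩
  · rintro ⟨x, hx, h1⟩
    have hs : VLC.IsServing h β y φ x := by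
      refine ⟨hx, fun z hz => ?_⟩
      rcases eq_or_ne x z with rfl | hxz
      · exact le_rfl
      · exact (lt_of_finsum_sub_add_lt hφ hpos (sq_nonneg σ) hτ hx hz hxz h1).le
    rw [VLC.servedSinr_eq h β σ y φ hs]
    exact (VLC.lt_sinr_iff hh hτ y hφ hx).2 h1

theorem VLC.measurable_pathLoss (h β : ℝ) (y : VLC.Plane) :
    Measurable fun x => VLC.pathLoss h β x y := by
  unfold VLC.pathLoss
  fun_prop

theorem VLC.pathLoss_le {h β : ℝ} (hh : 0 < h) (hβ : 0 < β) (x y : VLC.Plane) :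
    VLC.pathLoss h β x y ≤ (h ^ 2) ^ (-β) :=
  Real.rpow_le_rpow_of_nonpos (by positivity) (by nlinarith [sq_nonneg ‖x - y‖]) (by linarith)

theorem VLC.IsPoissonProcess.measure_lt_servedSinr [IsFiniteMeasure Λ] [IsProbabilityMeasure P]
    (hΦ : VLC.IsPoissonProcess Φ Λ P) {h β σ τ : ℝ} (hh : 0 < h) (hβ : 0 < β) (hτ : 1 ≤ τ)
    (y : VLC.Plane) :
    P {ω | ENNReal.ofReal τ < VLC.servedSinr h β σ y (Φ ω)}
      = ∫⁻ x, P {ω | ∑ᶠ w ∈ Φ ω, VLC.pathLoss h β w y + σ ^ 2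
          - VLC.pathLoss h β x y / τ < 0} ∂Λ := by
  rw [← hΦ.measure_exists_lt (VLC.measurable_pathLoss h β y)
    (fun x => Real.rpow_nonneg (by positivity) _) (fun x => VLC.pathLoss_le hh hβ x y)
    (sq_nonneg σ) hτ]
  refine measure_congr ?_
  filter_upwards [hΦ.ae_finite] with ω hω
  exact propext (VLC.lt_servedSinr_iff hh hτ y hω)

end Coverage

/-! ### The square room, the region `A_y` and the measure `κ`. -/

namespace VLC

theorem square_subset_closedBall (c : Plane) {a : ℝ} (ha : 0 < a) :
    square c a ⊆ Metric.closedBall c (2 * a) := by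
  intro x hx
  rw [mem_closedBall_iff_norm]
  refine abs_le_of_sq_le_sq' ?_ (by positivity) |>.2
  rw [EuclideanSpace.real_norm_sq_eq, Fin.sum_univ_two]
  have h := fun i => sq_le_sq' (abs_le.1 (hx i)).1 (abs_le.1 (hx i)).2
  have h0 := h 0
  have h1 := h 1
  simp only [PiLp.sub_apply]
  nlinarith

theorem measurableSet_square (c : Plane) (a : ℝ) : MeasurableSet (square c a) := by
  have : square c a = ⋂ i, {x : Plane | |x i - c i| ≤ a} := by ext; simp [square]
  rw [this]
  exact MeasurableSet.iInter fun i => measurableSet_le (by fun_prop) measurable_const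

theorem volume_square_lt_top (c : Plane) {a : ℝ} (ha : 0 < a) : volume (square c a) < ∞ :=
  (measure_mono (square_subset_closedBall c ha)).trans_lt measure_closedBall_lt_top

theorem regionA_subset_ball {a : ℝ} (ha : 0 < a) (h β σ τ : ℝ) (y : Plane) :
    regionA a h β σ τ y ⊆ Metric.ball 0 (‖y‖ + 2 * a + 1) := by
  intro x hx
  have h1 := square_subset_closedBall (-y) ha hx.1
  rw [mem_closedBall_iff_norm] at h1
  rw [mem_ball_zero_iff]
  have h2 := norm_add_le (x - -y) (-y)
  rw [sub_add_cancel, norm_neg] at h2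
  linarith

theorem measurePreserving_sub_square (a : ℝ) (y : Plane) :
    MeasurePreserving (fun x : Plane => x - y) (volume.restrict (square 0 a))
      (volume.restrict (square (-y) a)) := by
  have h := (measurePreserving_sub_right (volume : Measure Plane) y).restrict_preimage
    (measurableSet_square (-y) a)
  have e : (fun x : Plane => x - y) ⁻¹' square (-y) a = square 0 a := by
    ext x; simp [square]
  rwa [e] at h

/-- Outside the disc of radius `a_D`, the received power is below the noise level. -/
theorem pathLoss_div_le_of_notMem {h β σ τ : ℝ} (hβ : 0 < β) (hh : 0 < h) (hσ : 0 ≤ σ)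
    (hτ : 1 ≤ τ) {x : Plane} (hx : ¬ENNReal.ofReal ‖x‖ < radiusD h β σ τ) :
    (‖x‖ ^ 2 + h ^ 2) ^ (-β) / τ ≤ σ ^ 2 := by
  have hτ0 : 0 < τ := one_pos.trans_le hτ
  rw [not_lt, radiusD] at hx
  -- Without noise the radius is infinite, so no `x` lies outside the disc.
  rcases hσ.eq_or_lt with rfl | hσ0
  · exfalso
    rw [ENNReal.ofReal_zero, ENNReal.zero_rpow_of_neg (by simpa using hβ), ENNReal.mul_top,
      ENNReal.top_sub (by simp), ENNReal.top_rpow_of_pos (by norm_num)] at hx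
    · exact ENNReal.ofReal_ne_top (top_le_iff.1 hx)
    · rw [ENNReal.ofReal_rpow_of_pos hτ0]
      simpa using Real.rpow_pos_of_pos hτ0 _
  · rw [ENNReal.ofReal_rpow_of_pos hτ0, ENNReal.ofReal_rpow_of_pos hσ0,
      ← ENNReal.ofReal_mul (by positivity), ← ENNReal.ofReal_pow hh.le,
      ← ENNReal.ofReal_sub _ (by positivity)] at hx
    -- Squaring removes the root; truncated subtraction then still gives `τ^(-1/β) σ^(-2/β) ≤ ‖x‖² +
    -- h²`, and the decreasing power `-β` yields the noise bound.
    have h1 := ENNReal.rpow_le_rpow hx (z := 2) (by norm_num)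
    rw [← ENNReal.rpow_mul, one_div_mul_cancel two_ne_zero, ENNReal.rpow_one, ENNReal.rpow_two,
      ← ENNReal.ofReal_pow (norm_nonneg x), ENNReal.ofReal_le_ofReal_iff (by positivity),
      sub_le_iff_le_add] at h1
    have h2 := Real.rpow_le_rpow_of_nonpos (by positivity) h1 (neg_nonpos.2 hβ.le)
    rw [div_le_iff₀ hτ0]
    refine h2.trans_eq ?_
    rw [Real.mul_rpow (by positivity) (by positivity), ← Real.rpow_mul hτ0.le,
      ← Real.rpow_mul hσ0.le]
    have e1 : -(1 / β) * -β = 1 := by field_simp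
    have e2 : -(2 / β) * -β = 2 := by field_simp
    rw [e1, e2, Real.rpow_one, Real.rpow_two, mul_comm]

/-- The image of Lebesgue measure on `A_y` under the noise minus the scaled received power. -/
noncomputable def noiseMinusSignal (a h β σ τ : ℝ) (y : Plane) : Measure ℝ :=
  (volume.restrict (regionA a h β σ τ y)).map fun x => σ ^ 2 - (‖x‖ ^ 2 + h ^ 2) ^ (-β) / τ

theorem measurable_noise_sub_signal (h β σ τ : ℝ) :
    Measurable fun x : Plane => σ ^ 2 - (‖x‖ ^ 2 + h ^ 2) ^ (-β) / τ := by fun_prop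

theorem isFiniteMeasure_noiseMinusSignal {a : ℝ} (ha : 0 < a) (h β σ τ : ℝ) (y : Plane) :
    IsFiniteMeasure (noiseMinusSignal a h β σ τ y) := by
  have : IsFiniteMeasure (volume.restrict (regionA a h β σ τ y)) :=
    ⟨by
      rw [Measure.restrict_apply_univ]
      exact (measure_mono inter_subset_left).trans_lt (volume_square_lt_top _ ha)⟩
  exact Measure.isFiniteMeasure_map _ _

theorem noiseMinusSignal_singleton {h β : ℝ} (hh : 0 < h) (hβ : 0 < β) (a σ : ℝ) {τ : ℝ}
    (hτ : 1 ≤ τ) (y : Plane) (r : ℝ) : noiseMinusSignal a h β σ τ y {r} = 0 := by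
  have hτ0 : 0 < τ := one_pos.trans_le hτ
  rw [noiseMinusSignal, Measure.map_apply (measurable_noise_sub_signal _ _ _ _)
    (measurableSet_singleton _)]
  refine measure_mono_null (fun x hx => ?_)
    ((Measure.restrict_le_self (s := regionA a h β σ τ y)).absolutelyContinuous
      (volume_pathLoss_eq hh hβ ((σ ^ 2 - r) * τ)))
  have hx' : σ ^ 2 - (‖x‖ ^ 2 + h ^ 2) ^ (-β) / τ = r := hx
  show (‖x‖ ^ 2 + h ^ 2) ^ (-β) = (σ ^ 2 - r) * τ
  rw [← hx']
  field_simp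
  ring

theorem charFun_noiseMinusSignal (a h β σ τ : ℝ) (y : Plane) (t : ℝ) :
    charFun (noiseMinusSignal a h β σ τ y) t
      = Complex.exp (Complex.I * t * (σ : ℂ) ^ 2) *
        funF h β (Complex.I * t / τ) (regionA a h β σ τ y) := by
  rw [charFun_apply_real, noiseMinusSignal,
    integral_map (measurable_noise_sub_signal _ _ _ _).aemeasurable (by fun_prop : Continuous
      fun x : ℝ => Complex.exp (t * x * Complex.I)).aestronglyMeasurable, funF,
    ← integral_const_mul]
  congr 1 with x
  rw [← Complex.exp_add]
  push_cast
  ring_nf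

/-- An affine change of the value turns scale `R` into `R / τ` for the path loss itself, hence the
factor `τ` in the constant; a disc containing `A_y` then suffices. -/
theorem exists_integral_exp_noiseMinusSignal_le {a h β : ℝ} (ha : 0 < a) (hh : 0 < h) (hβ : 0 < β)
    (σ : ℝ) {τ : ℝ} (hτ : 1 ≤ τ) (y : Plane) : ∃ C : ℝ, ∀ R : ℝ, 0 < R → ∀ c : ℝ,
      ∫ z, Real.exp (-(R * (z - c)) ^ 2 / 2) ∂noiseMinusSignal a h β σ τ y ≤ C / R := by
  have hτ0 : 0 < τ := one_pos.trans_le hτ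
  obtain ⟨C, hC⟩ := exists_setIntegral_exp_pathLoss_le hh hβ (‖y‖ + 2 * a + 1)
  refine ⟨C * τ, fun R hR c => ?_⟩
  have h1 := hC (R / τ) (by positivity) ((σ ^ 2 - c) * τ)
  rw [div_div_eq_mul_div] at h1
  rw [noiseMinusSignal, integral_map (measurable_noise_sub_signal _ _ _ _).aemeasurable
    (by fun_prop : Continuous fun z : ℝ =>
      Real.exp (-(R * (z - c)) ^ 2 / 2)).aestronglyMeasurable]
  refine le_trans ?_ h1
  have e : ∀ x : Plane, Real.exp (-(R * (σ ^ 2 - (‖x‖ ^ 2 + h ^ 2) ^ (-β) / τ - c)) ^ 2 / 2)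
      = Real.exp (-(R / τ * ((‖x‖ ^ 2 + h ^ 2) ^ (-β) - (σ ^ 2 - c) * τ)) ^ 2 / 2) := fun x => by
    congr 1
    field_simp
    ring
  simp_rw [e]
  refine setIntegral_mono_set ?_ (Filter.Eventually.of_forall fun x => Real.exp_nonneg _)
    (regionA_subset_ball ha h β σ τ y).eventuallyLE
  refine Measure.integrableOn_of_bounded (M := 1) measure_ball_lt_top.ne ?_
    (Filter.Eventually.of_forall fun x => ?_)
  · have : Measurable fun x : Plane =>
        Real.exp (-(R / τ * ((‖x‖ ^ 2 + h ^ 2) ^ (-β) - (σ ^ 2 - c) * τ)) ^ 2 / 2) := by fun_prop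
    exact this.aestronglyMeasurable
  · rw [Real.norm_eq_abs, Real.abs_exp, Real.exp_le_one_iff]
    have := sq_nonneg (R / τ * ((‖x‖ ^ 2 + h ^ 2) ^ (-β) - (σ ^ 2 - c) * τ))
    linarith

theorem integrable_noiseMinusSignal {a h β : ℝ} (ha : 0 < a) (hh : 0 < h) (hβ : 0 < β) (σ : ℝ)
    {τ : ℝ} (hτ : 1 ≤ τ) (y : Plane) : Integrable id (noiseMinusSignal a h β σ τ y) := by
  have hτ0 : 0 < τ := one_pos.trans_le hτ
  rw [noiseMinusSignal, integrable_map_measure (by fun_prop)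
    (measurable_noise_sub_signal _ _ _ _).aemeasurable]
  refine Measure.integrableOn_of_bounded (M := σ ^ 2 + (h ^ 2) ^ (-β) / τ)
    ((measure_mono inter_subset_left).trans_lt (volume_square_lt_top (-y) ha)).ne
    (measurable_noise_sub_signal _ _ _ _).aestronglyMeasurable
    (Filter.Eventually.of_forall fun x => ?_)
  have h1 : (‖x‖ ^ 2 + h ^ 2) ^ (-β) / τ ≤ (h ^ 2) ^ (-β) / τ := by
    have := pathLoss_le hh hβ x 0
    rw [pathLoss, sub_zero] at this
    gcongr
  have h2 : 0 ≤ (‖x‖ ^ 2 + h ^ 2) ^ (-β) / τ := by positivity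
  have h3 := sq_nonneg σ
  rw [Function.comp, id, Real.norm_eq_abs, abs_le]
  constructor <;> linarith

theorem measure_add_sub_lt_eq_zero {Ω : Type*} [MeasurableSpace Ω] {P : Measure Ω}
    {Φ : Ω → Set Plane} {h β σ τ : ℝ} (hh : 0 < h) (hβ : 0 < β) (hσ : 0 ≤ σ) (hτ : 1 ≤ τ)
    (y : Plane) {x : Plane} (hx : ¬ENNReal.ofReal ‖x‖ < radiusD h β σ τ) :
    P {ω | ∑ᶠ w ∈ Φ ω, pathLoss h β w y + σ ^ 2 - (‖x‖ ^ 2 + h ^ 2) ^ (-β) / τ < 0} = 0 := by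
  convert! measure_empty (μ := P)
  refine eq_empty_of_forall_notMem fun ω hω => ?_
  have h1 := pathLoss_div_le_of_notMem hβ hh hσ hτ hx
  have h2 : 0 ≤ ∑ᶠ w ∈ Φ ω, pathLoss h β w y :=
    finsum_nonneg fun w => finsum_nonneg fun _ => Real.rpow_nonneg (by positivity) _
  have h3 : ∑ᶠ w ∈ Φ ω, pathLoss h β w y + σ ^ 2 - (‖x‖ ^ 2 + h ^ 2) ^ (-β) / τ < 0 := hω
  linarith

section

variable {Ω : Type*} [MeasurableSpace Ω] {P : Measure Ω} [IsProbabilityMeasure P]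
  {Φ : Ω → Set Plane} {lam a h β σ τ : ℝ}

theorem isFiniteMeasure_intensity (lam : ℝ) (ha : 0 < a) :
    IsFiniteMeasure (ENNReal.ofReal lam • (volume.restrict (square (0 : Plane) a))) := by
  have : IsFiniteMeasure (volume.restrict (square (0 : Plane) a)) :=
    ⟨by rw [Measure.restrict_apply_univ]; exact volume_square_lt_top _ ha⟩
  exact Measure.smul_finite _ ENNReal.ofReal_ne_top

theorem IsHomogeneousPoissonProcess.charFun_interference (hlam : 0 < lam) (ha : 0 < a)
    (hh : 0 < h) (hβ : 0 < β) (y : Plane) (hΦ : IsHomogeneousPoissonProcess Φ lam a P) (t : ℝ) :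
    charFun (P.map fun ω => ∑ᶠ x ∈ Φ ω, pathLoss h β x y) t
      = funK lam h β (Complex.I * t) (square (-y) a) := by
  have := isFiniteMeasure_intensity lam ha
  rw [IsPoissonProcess.charFun_finsum hΦ (measurable_pathLoss h β y)
    (fun x => Real.rpow_nonneg (by positivity) _) (fun x => pathLoss_le hh hβ x y),
    integral_smul_measure, ENNReal.toReal_ofReal hlam.le, funK,
    ← (measurePreserving_sub_square a y).integral_comp
      (MeasurableEquiv.subRight y).measurableEmbedding, neg_mul, ← mul_neg, ← integral_neg,
    Complex.real_smul]
  congr 3 with x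
  rw [neg_sub, pathLoss, Real.rpow_neg (by positivity), Complex.ofReal_inv]
  congr 2
  rw [div_eq_mul_inv]
  ring

/-- After translation by `y`, the Campbell integral over the part of the square outside the disc of
radius `a_D` is zero; the part over `A_y` is the convolution evaluated by Fubini. -/
theorem IsHomogeneousPoissonProcess.measure_lt_servedSinr (ha : 0 < a) (hh : 0 < h)
    (hβ : 0 < β) (hσ : 0 ≤ σ) (hτ : 1 ≤ τ) (y : Plane)
    (hΦ : IsHomogeneousPoissonProcess Φ lam a P) :
    P {ω | ENNReal.ofReal τ < servedSinr h β σ y (Φ ω)} = ENNReal.ofReal lam *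
      Measure.conv (P.map fun ω => ∑ᶠ x ∈ Φ ω, pathLoss h β x y)
        (noiseMinusSignal a h β σ τ y) (Iio 0) := by
  have := isFiniteMeasure_intensity lam ha
  have := isFiniteMeasure_noiseMinusSignal ha h β σ τ y
  have hJ := IsPoissonProcess.aemeasurable_finsum hΦ (measurable_pathLoss h β y)
    (fun x => Real.rpow_nonneg (by positivity) _) (fun x => pathLoss_le hh hβ x y)
  have hμ := Measure.isProbabilityMeasure_map hJ
  rw [IsPoissonProcess.measure_lt_servedSinr hΦ hh hβ hτ y, lintegral_smul_measure, smul_eq_mul]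
  congr 1
  have h1 := (measurePreserving_sub_square a y).lintegral_comp_emb
    (MeasurableEquiv.subRight y).measurableEmbedding fun x =>
      P {ω | ∑ᶠ w ∈ Φ ω, pathLoss h β w y + σ ^ 2 - (‖x‖ ^ 2 + h ^ 2) ^ (-β) / τ < 0}
  refine h1.trans ?_
  have hA : square (-y) a ∩ {x | ENNReal.ofReal ‖x‖ < radiusD h β σ τ} = regionA a h β σ τ y := rfl
  have hm : MeasurableSet {x : Plane | ENNReal.ofReal ‖x‖ < radiusD h β σ τ} :=
    measurableSet_lt (by fun_prop) measurable_const
  rw [← lintegral_inter_add_sdiff _ _ hm, hA, setLIntegral_congr_fun (g := fun _ => 0)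
    ((measurableSet_square _ _).diff hm)
    (fun x hx => measure_add_sub_lt_eq_zero hh hβ hσ hτ y hx.2), lintegral_zero, add_zero,
    Measure.conv, Measure.map_apply (by fun_prop) measurableSet_Iio,
    Measure.prod_apply_symm ((by fun_prop : Measurable fun p : ℝ × ℝ => p.1 + p.2)
      measurableSet_Iio), noiseMinusSignal, lintegral_map _ (measurable_noise_sub_signal _ _ _ _)]
  · refine lintegral_congr fun x => ?_
    rw [Measure.map_apply_of_aemeasurable hJ]
    · congr 1 with ω
      simp [add_sub_assoc]
    · exact measurable_prodMk_right
        ((by fun_prop : Measurable fun p : ℝ × ℝ => p.1 + p.2) measurableSet_Iio)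
  · exact measurable_measure_prodMk_right ((by fun_prop : Measurable fun p : ℝ × ℝ => p.1 + p.2)
      measurableSet_Iio)

end

end VLC

/-! ### Inversion of the convolution. -/

theorem theorem1 {Ω : Type*} [MeasurableSpace Ω] (P : Measure Ω) [IsProbabilityMeasure P]
    (Φ : Ω → Set VLC.Plane) (lam a h β σ τ : ℝ) (y : VLC.Plane)
    (hlam : 0 < lam) (ha : 0 < a) (hh : 0 < h) (hβ : 0 < β) (hσ : 0 ≤ σ) (hτ : 1 ≤ τ)
    (hΦ : VLC.IsHomogeneousPoissonProcess Φ lam a P) :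
    IntegrableOn (VLC.coverageIntegrand lam a h β σ τ y) (Ioi 0) ∧
    VLC.coverageProbability P Φ h β σ τ y =
      lam * volume.real (VLC.regionA a h β σ τ y) / 2 -
        lam / Real.pi * ∫ t in Ioi (0 : ℝ), VLC.coverageIntegrand lam a h β σ τ y t := by
  have := VLC.isFiniteMeasure_intensity lam ha
  have := VLC.isFiniteMeasure_noiseMinusSignal ha h β σ τ y
  have hnn : ∀ x, 0 ≤ VLC.pathLoss h β x y := fun x => Real.rpow_nonneg (by positivity) _
  have hJ := VLC.IsPoissonProcess.aemeasurable_finsum hΦ (VLC.measurable_pathLoss h β y) hnn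
    fun x => VLC.pathLoss_le hh hβ x y
  have hJi := VLC.IsPoissonProcess.integrable_finsum hΦ (VLC.measurable_pathLoss h β y) hnn
    fun x => VLC.pathLoss_le hh hβ x y
  set μ : Measure ℝ := P.map fun ω => ∑ᶠ x ∈ Φ ω, VLC.pathLoss h β x y with hμ
  have hμP : IsProbabilityMeasure μ := Measure.isProbabilityMeasure_map hJ
  set κ : Measure ℝ := VLC.noiseMinusSignal a h β σ τ y with hκ
  have hadd : Measurable fun p : ℝ × ℝ => p.1 + p.2 := by fun_prop
  have hνi : Integrable id (Measure.conv μ κ) := by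
    rw [Measure.conv, integrable_map_measure (by fun_prop) hadd.aemeasurable]
    have h1 : Integrable id μ := (integrable_map_measure (by fun_prop) hJ).2 hJi
    exact (h1.comp_fst κ).add ((VLC.integrable_noiseMinusSignal ha hh hβ σ hτ y).comp_snd μ)
  -- One factor without atoms is enough, and `κ` has none.
  have hν0 : Measure.conv μ κ {0} = 0 := by
    rw [Measure.conv, Measure.map_apply hadd (measurableSet_singleton _),
      Measure.prod_apply (hadd (measurableSet_singleton _))]
    refine lintegral_eq_zero_of_ae_eq_zero (Filter.Eventually.of_forall fun r => ?_)
    refine measure_mono_null (fun z hz => ?_)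
      (VLC.noiseMinusSignal_singleton hh hβ a σ hτ y (-r))
    have : r + z = 0 := hz
    rw [mem_singleton_iff]
    linarith
  have hchar : VLC.coverageIntegrand lam a h β σ τ y
      = fun t => 1 / t * (charFun (Measure.conv μ κ) t).im := by
    ext t
    rw [VLC.coverageIntegrand, charFun_conv,
      VLC.IsHomogeneousPoissonProcess.charFun_interference hlam ha hh hβ y hΦ,
      VLC.charFun_noiseMinusSignal, mul_comm (VLC.funK _ _ _ _ _)]
  have hint : IntegrableOn (fun t => 1 / t * (charFun (Measure.conv μ κ) t).im) (Ioi 0) := by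
    have hm : Measurable fun t => 1 / t * (charFun (Measure.conv μ κ) t).im := by
      have := (measurable_charFun (μ := Measure.conv μ κ))
      fun_prop
    -- On `(0, 1]` the first moment of the convolution bounds the integrand; beyond `1` the factor
    -- of `μ` has norm at most `1` and `κ` supplies the decay.
    rw [← Ioc_union_Ioi_eq_Ioi zero_le_one]
    refine IntegrableOn.union ?_ ?_
    · exact Measure.integrableOn_of_bounded (M := ∫ x, |x| ∂Measure.conv μ κ) (by simp)
        hm.aestronglyMeasurable (Filter.Eventually.of_forall (abs_charFun_im_div_le _ hνi))
    · obtain ⟨C, hC⟩ := VLC.exists_integral_exp_noiseMinusSignal_le ha hh hβ σ hτ y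
      refine (integrableOn_inv_mul_norm_charFun κ hC).mono' hm.aestronglyMeasurable ?_
      filter_upwards [ae_restrict_mem measurableSet_Ioi] with t ht
      have ht0 : (0 : ℝ) < t := one_pos.trans ht
      rw [norm_mul, Real.norm_of_nonneg (by positivity : (0 : ℝ) ≤ 1 / t)]
      gcongr
      refine (Complex.abs_im_le_norm _).trans ?_
      rw [charFun_conv, norm_mul]
      exact mul_le_of_le_one_left (norm_nonneg _) (norm_charFun_le_one t)
  have huniv : (Measure.conv μ κ).real univ = volume.real (VLC.regionA a h β σ τ y) := by
    rw [Measure.conv, measureReal_def, Measure.map_apply hadd .univ, preimage_univ,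
      ← univ_prod_univ, Measure.prod_prod, measure_univ, one_mul, hκ, VLC.noiseMinusSignal,
      Measure.map_apply (VLC.measurable_noise_sub_signal _ _ _ _) .univ, preimage_univ,
      Measure.restrict_apply_univ, measureReal_def]
  refine ⟨hchar ▸ hint, ?_⟩
  rw [VLC.coverageProbability, measureReal_def,
    VLC.IsHomogeneousPoissonProcess.measure_lt_servedSinr ha hh hβ hσ hτ y hΦ,
    ENNReal.toReal_mul, ENNReal.toReal_ofReal hlam.le, ← measureReal_def,
    measureReal_Iio_zero_eq _ hνi hν0 hint, huniv, hchar]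
  ring
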